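/- Let $\mathcal M=\mathbb H^2$ with quaternionic coordinates $q_1,q_2$ and the flat metric, let $\mathrm U(1)$ act on $\mathcal M$ by $q_a\mapsto q_a e^{it}$, and let $\mu(q_1,q_2)=\tfrac12\sum_{a=1}^2 q_a\, i\,\overline{q_a}$ be its hyperkähler moment map. Let $X_{\mathrm{EH}}=\mu^{-1}(i/2)/\mathrm U(1)$ be Eguchi–Hanson space, with the quotient smooth structure, the quotient Riemannian metric (for which $\mu^{-1}(i/2)\to X_{\mathrm{EH}}$ is a Riemannian submersion), and the complex structure $I$ induced by left multiplication by $i$ on horizontal vectors. Let $G$ be the group of holomorphic isometries of $X_{\mathrm{EH}}$, that is, of all diffeomorphisms $X_{\mathrm{EH}}\to X_{\mathrm{EH}}$ that preserve the metric and whose derivative commutes with $I$. Then $G\cong \mathrm U(2)/\{\pm1\}$. More precisely: the left action $q_a\mapsto \lambda q_a$ of $\lambda\in\mathrm U(1)$ and the right action $(q_1,q_2)\mapsto(q_1,q_2)A$ of $A\in\mathrm{SU}(2)$ (complex matrices being viewed as quaternionic matrices without $j$ and $k$ components) preserve $\mu^{-1}(i/2)$ and descend to commuting actions on $X_{\mathrm{EH}}$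 by holomorphic isometries; in each of the two groups exactly $\pm1$ acts trivially on $X_{\mathrm{EH}}$; and there is a group isomorphism $\Phi:\mathrm U(2)/\{\pm1\}\to G$ with \[ \Phi([\lambda A])\,[q]=[\lambda\, q\, A^{-1}]\qquad\text{for all }\lambda\in\mathrm U(1),\ A\in\mathrm{SU}(2),\ q\in\mu^{-1}(i/2). \] -/

import Mathlib

noncomputable section

namespace EguchiHanson

open scoped Quaternion Manifold ContDiff Matrix ComplexConjugate

/-! ### The flat hyperkähler space and the hyperkähler moment map -/

/-- The flat space `ℍ²` with quaternionic coordinates `q₀, q₁`. Only its topology and linear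
structure are used; the flat metric is `flatInner`. -/
abbrev Flat : Type := Fin 2 → ℍ[ℝ]

/-- The flat Riemannian metric on `ℍ²`. -/
def flatInner (ξ η : Flat) : ℝ := ∑ a, inner ℝ (ξ a) (η a)

/-- The quaternion `i`. -/
def qi : ℍ[ℝ] := ((Complex.I : ℂ) : ℍ[ℝ])

@[simp] lemma qi_re : qi.re = 0 := rfl

@[simp] lemma qi_imI : qi.imI = 1 := rfl

@[simp] lemma qi_imJ : qi.imJ = 0 := rfl

@[simp] lemma qi_imK : qi.imK = 0 := rfl

/-- The hyperkähler moment map `μ(q) = ½ ∑ₐ qₐ i q̄ₐ` of the action `qₐ ↦ qₐ e^{it}`. -/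
def momentMap (q : Flat) : ℍ[ℝ] := (1 / 2 : ℝ) • ∑ a, q a * qi * star (q a)

/-- The level set `μ⁻¹(i/2)`. -/
abbrev LevelSet : Type := {q : Flat // momentMap q = (1 / 2 : ℝ) • qi}

/-- Writing `qₐ = z + w j` with `z, w ∈ ℂ`, this is the coordinate `z`. -/
def zc (a : Fin 2) : Flat →L[ℝ] ℂ :=
  LinearMap.toContinuousLinearMap
    { toFun := fun q => ⟨(q a).re, (q a).imI⟩
      map_add' := fun _ _ => by apply Complex.ext <;> simp
      map_smul' := fun _ _ => by apply Complex.ext <;> simp }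

/-- Writing `qₐ = z + w j` with `z, w ∈ ℂ`, this is the coordinate `w`. -/
def wc (a : Fin 2) : Flat →L[ℝ] ℂ :=
  LinearMap.toContinuousLinearMap
    { toFun := fun q => ⟨(q a).imJ, (q a).imK⟩
      map_add' := fun _ _ => by apply Complex.ext <;> simp
      map_smul' := fun _ _ => by apply Complex.ext <;> simp }

lemma zc_apply (a : Fin 2) (q : Flat) : zc a q = ⟨(q a).re, (q a).imI⟩ := rfl

lemma wc_apply (a : Fin 2) (q : Flat) : wc a q = ⟨(q a).imJ, (q a).imK⟩ := rfl

lemma flat_ext {p q : Flat} (hz : ∀ a, zc a p = zc a q) (hw : ∀ a, wc a p = wc a q) : p = q := by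
  funext a
  have h1 := hz a
  have h2 := hw a
  simp only [zc_apply, wc_apply, Complex.mk.injEq] at h1 h2
  exact QuaternionAlgebra.ext h1.1 h1.2 h2.1 h2.2

/-- The point of `ℍ²` with given complex coordinates. -/
def ofZW (z w : Fin 2 → ℂ) : Flat := fun a => ⟨(z a).re, (z a).im, (w a).re, (w a).im⟩

@[simp] lemma zc_ofZW (a : Fin 2) (z w : Fin 2 → ℂ) : zc a (ofZW z w) = z a := rfl

@[simp] lemma wc_ofZW (a : Fin 2) (z w : Fin 2 → ℂ) : wc a (ofZW z w) = w a := rfl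

lemma momentMap_eq_iff (q : Flat) : momentMap q = (1 / 2 : ℝ) • qi ↔
    (zc 0 q * conj (zc 0 q) + zc 1 q * conj (zc 1 q)
        - wc 0 q * conj (wc 0 q) - wc 1 q * conj (wc 1 q) = 1 ∧
      zc 0 q * wc 0 q + zc 1 q * wc 1 q = 0) := by
  simp only [momentMap, Fin.sum_univ_two, zc_apply, wc_apply]
  constructor
  · intro h
    have h1 := congrArg QuaternionAlgebra.imI h
    have h2 := congrArg QuaternionAlgebra.imJ h
    have h3 := congrArg QuaternionAlgebra.imK h
    simp at h1 h2 h3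
    constructor <;> apply Complex.ext <;> simp <;> linarith
  · rintro ⟨h1, h2⟩
    have h0 := congrArg Complex.re h1
    have h3 := congrArg Complex.re h2
    have h4 := congrArg Complex.im h2
    simp at h0 h3 h4
    ext <;> simp <;> linarith

/-! ### The group actions on `μ⁻¹(i/2)` -/

lemma zc_mul_right (a : Fin 2) (q : Flat) (c : ℂ) :
    zc a (fun b => q b * (c : ℍ[ℝ])) = zc a q * c := by
  apply Complex.ext <;> simp [zc_apply]

lemma wc_mul_right (a : Fin 2) (q : Flat) (c : ℂ) :
    wc a (fun b => q b * (c : ℍ[ℝ])) = wc a q * conj c := by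
  apply Complex.ext <;> simp [wc_apply]

lemma zc_mul_left (a : Fin 2) (q : Flat) (c : ℂ) :
    zc a (fun b => (c : ℍ[ℝ]) * q b) = c * zc a q := by
  apply Complex.ext <;> simp [zc_apply]

lemma wc_mul_left (a : Fin 2) (q : Flat) (c : ℂ) :
    wc a (fun b => (c : ℍ[ℝ]) * q b) = c * wc a q := by
  apply Complex.ext <;> simp [wc_apply]

lemma circle_mul_conj (t : Circle) : (t : ℂ) * conj (t : ℂ) = 1 := by
  rw [Complex.mul_conj, Circle.normSq_coe, Complex.ofReal_one]

/-- The action `qₐ ↦ qₐ e^{it}` of `U(1)` on `μ⁻¹(i/2)`. -/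
instance : MulAction Circle LevelSet where
  smul t q := ⟨fun a => q.1 a * ((t : ℂ) : ℍ[ℝ]), by
    obtain ⟨h1, h2⟩ := (momentMap_eq_iff q.1).1 q.2
    have ht := circle_mul_conj t
    rw [momentMap_eq_iff]
    simp only [zc_mul_right, wc_mul_right, map_mul, Complex.conj_conj]
    constructor
    · linear_combination (t : ℂ) * conj (t : ℂ) * h1 + ht
    · linear_combination (t : ℂ) * conj (t : ℂ) * h2⟩
  one_smul q := Subtype.ext (funext fun a => by
    change q.1 a * (((1 : Circle) : ℂ) : ℍ[ℝ]) = q.1 a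
    simp)
  mul_smul s t q := Subtype.ext (funext fun a => by
    change q.1 a * (((s * t : Circle) : ℂ) : ℍ[ℝ])
      = q.1 a * ((t : ℂ) : ℍ[ℝ]) * ((s : ℂ) : ℍ[ℝ])
    rw [mul_comm s t, Circle.coe_mul, Quaternion.coeComplex_mul, mul_assoc])

lemma coe_smul (t : Circle) (q : LevelSet) :
    (t • q).1 = fun a => q.1 a * ((t : ℂ) : ℍ[ℝ]) := rfl

/-- The action `qₐ ↦ e^{it} qₐ` of `U(1)` from the left on `μ⁻¹(i/2)`. -/
def leftMul (t : Circle) (q : LevelSet) : LevelSet :=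
  ⟨fun a => ((t : ℂ) : ℍ[ℝ]) * q.1 a, by
    obtain ⟨h1, h2⟩ := (momentMap_eq_iff q.1).1 q.2
    have ht := circle_mul_conj t
    rw [momentMap_eq_iff]
    simp only [zc_mul_left, wc_mul_left, map_mul]
    constructor
    · linear_combination (t : ℂ) * conj (t : ℂ) * h1 + ht
    · linear_combination (t : ℂ) * (t : ℂ) * h2⟩

lemma zc_vecMul (b : Fin 2) (q : Flat) (A : Matrix (Fin 2) (Fin 2) ℂ) :
    zc b (q ᵥ* A.map Quaternion.coeComplex) = zc 0 q * A 0 b + zc 1 q * A 1 b := by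
  apply Complex.ext <;> simp [zc_apply, Matrix.vecMul, dotProduct, Fin.sum_univ_two]

lemma wc_vecMul (b : Fin 2) (q : Flat) (A : Matrix (Fin 2) (Fin 2) ℂ) :
    wc b (q ᵥ* A.map Quaternion.coeComplex)
      = wc 0 q * conj (A 0 b) + wc 1 q * conj (A 1 b) := by
  apply Complex.ext <;> simp [wc_apply, Matrix.vecMul, dotProduct, Fin.sum_univ_two]

/-- The action of `SU(2)` on `μ⁻¹(i/2)` from the right, by multiplying the row vector `(q₀, q₁)`
with the matrix, which is viewed as a quaternionic matrix without `j` and `k` components. -/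
def rightMul (q : LevelSet) (A : Matrix.specialUnitaryGroup (Fin 2) ℂ) : LevelSet :=
  ⟨q.1 ᵥ* (A : Matrix (Fin 2) (Fin 2) ℂ).map Quaternion.coeComplex, by
    obtain ⟨h1, h2⟩ := (momentMap_eq_iff q.1).1 q.2
    have hA := (Matrix.mem_unitaryGroup_iff.1
      (Matrix.specialUnitaryGroup_le_unitaryGroup A.2))
    have e00 := congrFun (congrFun hA 0) 0
    have e01 := congrFun (congrFun hA 0) 1
    have e10 := congrFun (congrFun hA 1) 0
    have e11 := congrFun (congrFun hA 1) 1
    simp [Matrix.mul_apply, Fin.sum_univ_two, Matrix.star_apply] at e00 e01 e10 e11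
    rw [momentMap_eq_iff]
    simp only [zc_vecMul, wc_vecMul, map_mul, map_add, Complex.conj_conj]
    generalize zc 0 q.1 = z0 at *
    generalize zc 1 q.1 = z1 at *
    generalize wc 0 q.1 = w0 at *
    generalize wc 1 q.1 = w1 at *
    constructor
    · linear_combination h1 + (z0 * conj z0 - w0 * conj w0) * e00
        + (z1 * conj z1 - w1 * conj w1) * e11
        + (z0 * conj z1 - w1 * conj w0) * e01 + (z1 * conj z0 - w0 * conj w1) * e10
    · linear_combination h2 + z0 * w0 * e00 + z1 * w1 * e11 + z0 * w1 * e01 + z1 * w0 * e10⟩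

/-! ### The quotient `μ⁻¹(i/2) / U(1)` as a smooth manifold -/

/-- Eguchi–Hanson space, the quotient of `μ⁻¹(i/2)` by the action `qₐ ↦ qₐ e^{it}` of `U(1)`. -/
def Space : Type := MulAction.orbitRel.Quotient Circle LevelSet

/-- It carries the quotient topology. -/
instance : TopologicalSpace Space :=
  inferInstanceAs (TopologicalSpace (Quotient (MulAction.orbitRel Circle LevelSet)))

/-- The projection `μ⁻¹(i/2) → μ⁻¹(i/2) / U(1)`. -/
def proj (q : LevelSet) : Space := Quotient.mk (MulAction.orbitRel Circle LevelSet) q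

lemma proj_eq_iff {p q : LevelSet} : proj p = proj q ↔ ∃ t : Circle, t • q = p :=
  Quotient.eq (r := MulAction.orbitRel Circle LevelSet)

lemma proj_surjective : Function.Surjective proj := Quotient.mk_surjective

lemma continuous_proj : Continuous proj := continuous_quotient_mk'

lemma isOpen_iff {U : Set Space} : IsOpen U ↔ IsOpen (proj ⁻¹' U) :=
  isQuotientMap_quotient_mk'.isOpen_preimage.symm

lemma continuous_coe : Continuous (fun q : LevelSet => q.1) := continuous_subtype_val

/-- The `U(1)`-invariant functions `(z_b / z_a, z_a w_b)`, `{a, b} = {0, 1}`, which serve as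
coordinates on the quotient where `z_a ≠ 0`. They are smooth on the open set `z_a ≠ 0` of `ℍ²`. -/
def coord (a : Fin 2) (q : Flat) : ℂ × ℂ :=
  (zc (1 - a) q / zc a q, zc a q * wc (1 - a) q)

lemma zc_smul (a : Fin 2) (t : Circle) (q : LevelSet) : zc a (t • q).1 = zc a q.1 * t := by
  rw [coe_smul, zc_mul_right]

lemma wc_smul (a : Fin 2) (t : Circle) (q : LevelSet) :
    wc a (t • q).1 = wc a q.1 * conj (t : ℂ) := by
  rw [coe_smul, wc_mul_right]

lemma coord_smul (a : Fin 2) (t : Circle) (q : LevelSet) : coord a (t • q).1 = coord a q.1 := by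
  have ht := circle_mul_conj t
  have h0 : (t : ℂ) ≠ 0 := t.coe_ne_zero
  simp only [coord, zc_smul, wc_smul, Prod.mk.injEq]
  constructor
  · rw [mul_div_mul_right _ _ h0]
  · linear_combination zc a q.1 * wc (1 - a) q.1 * ht

/-- The function induced by `coord a` on the quotient. -/
def chartFun (a : Fin 2) : Space → ℂ × ℂ :=
  Quotient.lift (fun q : LevelSet => coord a q.1) (by
    rintro p q ⟨t, rfl⟩
    exact coord_smul a t q)

@[simp] lemma chartFun_proj (a : Fin 2) (q : LevelSet) : chartFun a (proj q) = coord a q.1 := rfl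

/-- The open set `z_a ≠ 0` of the quotient. -/
def chartSource (a : Fin 2) : Set Space := proj '' {q | zc a q.1 ≠ 0}

lemma proj_mem_chartSource {a : Fin 2} {q : LevelSet} :
    proj q ∈ chartSource a ↔ zc a q.1 ≠ 0 := by
  constructor
  · rintro ⟨p, hp, h⟩
    obtain ⟨t, rfl⟩ := proj_eq_iff.1 h
    rw [Set.mem_ofPred_eq, zc_smul] at hp
    exact left_ne_zero_of_mul hp
  · intro h
    exact ⟨q, h, rfl⟩

lemma isOpen_chartSource (a : Fin 2) : IsOpen (chartSource a) := by
  rw [isOpen_iff]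
  have : proj ⁻¹' chartSource a = {q : LevelSet | zc a q.1 ≠ 0} := by
    ext q
    exact proj_mem_chartSource
  rw [this]
  exact isOpen_ne_fun ((zc a).continuous.comp continuous_coe) continuous_const

lemma exists_mem_chartSource (x : Space) : x ∈ chartSource 0 ∨ x ∈ chartSource 1 := by
  obtain ⟨q, rfl⟩ := proj_surjective x
  rw [proj_mem_chartSource, proj_mem_chartSource]
  by_contra! h
  obtain ⟨h1, -⟩ := (momentMap_eq_iff q.1).1 q.2
  rw [h.1, h.2] at h1
  have := congrArg Complex.re h1
  simp at this
  nlinarith [sq_nonneg (wc 0 q.1).re, sq_nonneg (wc 0 q.1).im, sq_nonneg (wc 1 q.1).re,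
    sq_nonneg (wc 1 q.1).im]

/-- The value of `|z_a|²` at the point with coordinates `(u, v)`. -/
def sqModulus (y : ℂ × ℂ) : ℝ :=
  ((1 + Complex.normSq y.1)⁻¹ + √(((1 + Complex.normSq y.1)⁻¹) ^ 2 + 4 * Complex.normSq y.2)) / 2

lemma inv_pos' (y : ℂ × ℂ) : 0 < (1 + Complex.normSq y.1)⁻¹ :=
  inv_pos.2 (by have := Complex.normSq_nonneg y.1; linarith)

lemma radicand_pos (y : ℂ × ℂ) :
    0 < ((1 + Complex.normSq y.1)⁻¹) ^ 2 + 4 * Complex.normSq y.2 := by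
  have := Complex.normSq_nonneg y.2
  have := inv_pos' y
  positivity

lemma sqModulus_pos (y : ℂ × ℂ) : 0 < sqModulus y := by
  have h := inv_pos' y
  unfold sqModulus
  positivity

lemma sqModulus_eq (y : ℂ × ℂ) :
    (sqModulus y ^ 2 - Complex.normSq y.2) * (1 + Complex.normSq y.1) = sqModulus y := by
  have h1 : (1 + Complex.normSq y.1) ≠ 0 := by
    have := Complex.normSq_nonneg y.1
    positivity
  have h2 := Real.sq_sqrt (radicand_pos y).le
  have h3 := mul_inv_cancel₀ h1
  unfold sqModulus
  linear_combination (1 + Complex.normSq y.1) / 4 * h2 +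
    (2 * (1 + Complex.normSq y.1)⁻¹ / 4 +
      √(((1 + Complex.normSq y.1)⁻¹) ^ 2 + 4 * Complex.normSq y.2) / 2) * h3

lemma eq_sqModulus (y : ℂ × ℂ) (s : ℝ) (hs : 0 < s)
    (h : (s ^ 2 - Complex.normSq y.2) * (1 + Complex.normSq y.1) = s) : s = sqModulus y := by
  have h1 : (1 + Complex.normSq y.1) ≠ 0 := by
    have := Complex.normSq_nonneg y.1
    positivity
  have h3 := mul_inv_cancel₀ h1
  have hc := inv_pos' y
  have hv := Complex.normSq_nonneg y.2
  unfold sqModulus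
  set c := (1 + Complex.normSq y.1)⁻¹ with hcdef
  have h4 : s ^ 2 - c * s - Complex.normSq y.2 = 0 := by
    linear_combination c * h - (s ^ 2 - Complex.normSq y.2) * h3
  have h5 : c ≤ s := by
    by_contra! hlt
    nlinarith
  have h6 : √(c ^ 2 + 4 * Complex.normSq y.2) = 2 * s - c := by
    rw [show c ^ 2 + 4 * Complex.normSq y.2 = (2 * s - c) ^ 2 by linear_combination (-4) * h4]
    exact Real.sqrt_sq (by linarith)
  rw [h6]
  ring

/-- The point of `μ⁻¹(i/2)` with `z_a > 0` and with coordinates `(u, v)`. -/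
def sectionFlat (a : Fin 2) (y : ℂ × ℂ) : Flat :=
  ofZW (fun b => if b = a then (√(sqModulus y) : ℂ) else y.1 * (√(sqModulus y) : ℂ))
    (fun b => if b = a then -(y.1 * y.2 / (√(sqModulus y) : ℂ)) else y.2 / (√(sqModulus y) : ℂ))

lemma sqrt_ne_zero' (y : ℂ × ℂ) : (√(sqModulus y) : ℂ) ≠ 0 :=
  Complex.ofReal_ne_zero.2 (Real.sqrt_pos.2 (sqModulus_pos y)).ne'

lemma sqrt_sq' (y : ℂ × ℂ) : (√(sqModulus y) : ℂ) ^ 2 = (sqModulus y : ℂ) := by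
  rw [← Complex.ofReal_pow, Real.sq_sqrt (sqModulus_pos y).le]

lemma sectionFlat_mem (a : Fin 2) (y : ℂ × ℂ) :
    momentMap (sectionFlat a y) = (1 / 2 : ℝ) • qi := by
  have hr := sqrt_ne_zero' y
  have h1 := congrArg (fun s : ℝ => (s : ℂ)) (sqModulus_eq y)
  simp only [Complex.ofReal_mul, Complex.ofReal_sub, Complex.ofReal_add, Complex.ofReal_pow,
    Complex.ofReal_one, ← Complex.mul_conj, ← sqrt_sq' y] at h1
  rw [momentMap_eq_iff]
  unfold sectionFlat
  generalize (√(sqModulus y) : ℝ) = r at *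
  fin_cases a <;> simp <;> refine ⟨?_, ?_⟩ <;> field_simp <;>
    first | linear_combination h1 | ring

/-- The section `sectionFlat` with values in `μ⁻¹(i/2)`. -/
def sectionMap (a : Fin 2) (y : ℂ × ℂ) : LevelSet := ⟨sectionFlat a y, sectionFlat_mem a y⟩

lemma coord_section (a : Fin 2) (y : ℂ × ℂ) : coord a (sectionFlat a y) = y := by
  have hr := sqrt_ne_zero' y
  obtain ⟨u, v⟩ := y
  unfold coord sectionFlat
  generalize (√(sqModulus (u, v)) : ℝ) = r at *
  fin_cases a <;> simp <;> constructor <;> field_simp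

lemma zc_section (a : Fin 2) (y : ℂ × ℂ) : zc a (sectionFlat a y) = (√(sqModulus y) : ℂ) := by
  simp [sectionFlat]

lemma normSq_zc_eq (a : Fin 2) (q : LevelSet) (h : zc a q.1 ≠ 0) :
    Complex.normSq (zc a q.1) = sqModulus (coord a q.1) := by
  obtain ⟨h1, h2⟩ := (momentMap_eq_iff q.1).1 q.2
  have h' : conj (zc a q.1) ≠ 0 := (map_ne_zero _).2 h
  refine eq_sqModulus _ _ (Complex.normSq_pos.2 h) ?_
  apply Complex.ofReal_injective
  simp only [Complex.ofReal_mul, Complex.ofReal_sub, Complex.ofReal_add, Complex.ofReal_pow,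
    Complex.ofReal_one, ← Complex.mul_conj, coord, map_mul, Complex.normSq_div,
    Complex.ofReal_div]
  have h3 := congrArg (starRingEnd ℂ) h2
  simp only [map_add, map_mul, map_zero] at h3
  obtain rfl | rfl : a = 0 ∨ a = 1 := by fin_cases a <;> simp
  all_goals
    simp only [show (1 - 0 : Fin 2) = 1 from rfl, show (1 - 1 : Fin 2) = 0 from rfl]
    field_simp
  · linear_combination h1 *  (zc 0 q.1 * conj (zc 0 q.1)) +
      (conj (zc 0 q.1) * conj (wc 0 q.1)) * h2 - (zc 1 q.1 * wc 1 q.1) * h3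
  · linear_combination h1 *  (zc 1 q.1 * conj (zc 1 q.1)) +
      (conj (zc 1 q.1) * conj (wc 1 q.1)) * h2 - (zc 0 q.1 * wc 0 q.1) * h3

lemma proj_section (a : Fin 2) (q : LevelSet) (h : zc a q.1 ≠ 0) :
    proj (sectionMap a (coord a q.1)) = proj q := by
  have hs := congrArg (fun s : ℝ => (s : ℂ)) (normSq_zc_eq a q h)
  have hr := sqrt_ne_zero' (coord a q.1)
  obtain ⟨-, h2⟩ := (momentMap_eq_iff q.1).1 q.2
  simp only [← Complex.mul_conj, ← sqrt_sq'] at hs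
  have hn : ‖zc a q.1‖ = √(sqModulus (coord a q.1)) := by
    rw [← normSq_zc_eq a q h]
    rfl
  have hmem : zc a q.1 / (√(sqModulus (coord a q.1)) : ℂ) ∈ Submonoid.unitSphere ℂ := by
    change _ ∈ Metric.sphere (0 : ℂ) 1
    rw [mem_sphere_zero_iff_norm, norm_div, hn, Complex.norm_real, Real.norm_eq_abs,
      abs_of_nonneg (Real.sqrt_nonneg _)]
    exact div_self (Real.sqrt_pos.2 (sqModulus_pos _)).ne'
  obtain ⟨t, ht⟩ : ∃ t : Circle, (t : ℂ) = zc a q.1 / (√(sqModulus (coord a q.1)) : ℂ) :=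
    ⟨⟨_, hmem⟩, rfl⟩
  refine (proj_eq_iff.2 ⟨t, ?_⟩).symm
  · apply Subtype.ext
    have hc : conj (√(sqModulus (coord a q.1)) : ℂ) = (√(sqModulus (coord a q.1)) : ℂ) :=
      Complex.conj_ofReal _
    apply flat_ext
    · intro b
      rw [zc_smul, ht]
      change zc b (sectionFlat a _) * (zc a q.1 / _) = _
      unfold sectionFlat
      generalize (√(sqModulus (coord a q.1)) : ℂ) = r at *
      by_cases hb : b = a
      · subst hb
        simp
        field_simp
      · have : b = 1 - a := by fin_cases a <;> fin_cases b <;> simp at hb ⊢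
        subst this
        simp [hb, coord]
        field_simp
    · intro b
      rw [wc_smul, ht]
      change wc b (sectionFlat a _) * conj (zc a q.1 / _) = _
      unfold sectionFlat
      rw [map_div₀, hc]
      generalize (√(sqModulus (coord a q.1)) : ℂ) = r at *
      by_cases hb : b = a
      · subst hb
        simp [coord]
        field_simp
        rw [← hs]
        fin_cases b <;> simp
        · linear_combination (-conj (zc 0 q.1)) * h2
        · linear_combination (-conj (zc 1 q.1)) * h2
      · have : b = 1 - a := by fin_cases a <;> fin_cases b <;> simp at hb ⊢
        subst this
        simp [hb, coord]
        field_simp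
        linear_combination wc (1 - a) q.1 * hs

lemma contDiff_normSq : ContDiff ℝ ω Complex.normSq := by
  have : Complex.normSq = fun z : ℂ => Complex.reCLM z * Complex.reCLM z
      + Complex.imCLM z * Complex.imCLM z := by
    funext z
    rfl
  rw [this]
  fun_prop

lemma contDiff_sqModulus : ContDiff ℝ ω sqModulus := by
  have h1 : ContDiff ℝ ω fun y : ℂ × ℂ => Complex.normSq y.1 := contDiff_normSq.comp contDiff_fst
  have h2 : ContDiff ℝ ω fun y : ℂ × ℂ => Complex.normSq y.2 := contDiff_normSq.comp contDiff_snd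
  have h3 : ContDiff ℝ ω fun y : ℂ × ℂ => (1 + Complex.normSq y.1)⁻¹ :=
    (contDiff_const.add h1).inv fun y => by
      have := Complex.normSq_nonneg y.1
      positivity
  exact (h3.add (((h3.pow 2).add (contDiff_const.mul h2)).sqrt
    fun y => (radicand_pos y).ne')).div_const 2

lemma contDiff_ofZW : ContDiff ℝ ω fun p : (Fin 2 → ℂ) × (Fin 2 → ℂ) => ofZW p.1 p.2 :=
  (LinearMap.toContinuousLinearMap
    { toFun := fun p : (Fin 2 → ℂ) × (Fin 2 → ℂ) => ofZW p.1 p.2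
      map_add' := fun _ _ => flat_ext (fun _ => by simp) (fun _ => by simp)
      map_smul' := fun _ _ => flat_ext (fun _ => by simp) (fun _ => by simp) }).contDiff

lemma contDiff_sectionFlat (a : Fin 2) : ContDiff ℝ ω (sectionFlat a) := by
  have h0 : ContDiff ℝ ω fun y : ℂ × ℂ => (√(sqModulus y) : ℂ) :=
    Complex.ofRealCLM.contDiff.comp (contDiff_sqModulus.sqrt fun y => (sqModulus_pos y).ne')
  have h1 : ContDiff ℝ ω fun y : ℂ × ℂ => y.2 / (√(sqModulus y) : ℂ) :=
    contDiff_snd.mul (h0.inv sqrt_ne_zero')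
  have h2 : ContDiff ℝ ω fun y : ℂ × ℂ => y.1 * y.2 / (√(sqModulus y) : ℂ) :=
    (contDiff_fst.mul contDiff_snd).mul (h0.inv sqrt_ne_zero')
  have hz : ContDiff ℝ ω fun (y : ℂ × ℂ) (b : Fin 2) =>
      if b = a then (√(sqModulus y) : ℂ) else y.1 * (√(sqModulus y) : ℂ) := by
    refine contDiff_pi.2 fun b => ?_
    by_cases hb : b = a
    · simpa only [if_pos hb] using h0
    · simpa only [if_neg hb] using contDiff_fst.mul h0
  have hw : ContDiff ℝ ω fun (y : ℂ × ℂ) (b : Fin 2) =>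
      if b = a then -(y.1 * y.2 / (√(sqModulus y) : ℂ)) else y.2 / (√(sqModulus y) : ℂ) := by
    refine contDiff_pi.2 fun b => ?_
    by_cases hb : b = a
    · simpa only [if_pos hb] using h2.neg
    · simpa only [if_neg hb] using h1
  exact contDiff_ofZW.comp (hz.prodMk hw)

lemma continuous_sectionMap (a : Fin 2) : Continuous (sectionMap a) :=
  (contDiff_sectionFlat a).continuous.subtype_mk _

/-- The chart `[q] ↦ (z_b / z_a, z_a w_b)` on the open set `z_a ≠ 0` of the quotient. It is a
bijection onto `ℂ²`, with inverse induced by the smooth local section `sectionFlat a`. -/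
def chart (a : Fin 2) : OpenPartialHomeomorph Space (ℂ × ℂ) where
  toFun := chartFun a
  invFun y := proj (sectionMap a y)
  source := chartSource a
  target := Set.univ
  map_source' _ _ := Set.mem_univ _
  map_target' y _ := by
    rw [proj_mem_chartSource]
    change zc a (sectionFlat a y) ≠ 0
    rw [zc_section]
    exact sqrt_ne_zero' y
  left_inv' x hx := by
    obtain ⟨q, rfl⟩ := proj_surjective x
    exact proj_section a q (proj_mem_chartSource.1 hx)
  right_inv' y _ := coord_section a y
  open_source := isOpen_chartSource a
  open_target := isOpen_univ
  continuousOn_toFun := by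
    rw [continuousOn_open_iff (isOpen_chartSource a)]
    intro t ht
    rw [isOpen_iff]
    have h1 : ContinuousOn (fun q : LevelSet => coord a q.1) {q | zc a q.1 ≠ 0} := by
      have hz : ∀ b, Continuous fun q : LevelSet => zc b q.1 :=
        fun b => (zc b).continuous.comp continuous_coe
      have hw : ∀ b, Continuous fun q : LevelSet => wc b q.1 :=
        fun b => (wc b).continuous.comp continuous_coe
      exact ((hz _).continuousOn.div (hz _).continuousOn fun q hq => hq).prodMk
        ((hz _).mul (hw _)).continuousOn
    have h2 : IsOpen {q : LevelSet | zc a q.1 ≠ 0} :=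
      isOpen_ne_fun ((zc a).continuous.comp continuous_coe) continuous_const
    have h3 := (continuousOn_open_iff h2).1 h1 t ht
    convert h3 using 1
    ext q
    exact and_congr proj_mem_chartSource Iff.rfl
  continuousOn_invFun := (continuous_proj.comp (continuous_sectionMap a)).continuousOn

open Classical in
/-- The index of the preferred chart at a point. -/
def chartIndex (x : Space) : Fin 2 := if x ∈ chartSource 0 then 0 else 1

lemma mem_chartSource_chartIndex (x : Space) : x ∈ chartSource (chartIndex x) := by
  unfold chartIndex
  split_ifs with h
  · exact h
  · exact (exists_mem_chartSource x).resolve_left h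

instance : ChartedSpace (ℂ × ℂ) Space where
  atlas := Set.range chart
  chartAt x := chart (chartIndex x)
  mem_chart_source := mem_chartSource_chartIndex
  chart_mem_atlas _ := Set.mem_range_self _

lemma chart_symm_trans (a : Fin 2) {y : ℂ × ℂ} (hy : y.1 ≠ 0) :
    chart (1 - a) ((chart a).symm y) = (y.1⁻¹, -(y.1 ^ 2 * y.2)) := by
  change coord (1 - a) (sectionFlat a y) = _
  have hr := sqrt_ne_zero' y
  unfold coord sectionFlat
  generalize (√(sqModulus y) : ℝ) = r at *
  fin_cases a <;> simp <;> constructor <;> field_simp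

lemma ne_zero_of_mem (a : Fin 2) {y : ℂ × ℂ} (hy : (chart a).symm y ∈ (chart (1 - a)).source) :
    y.1 ≠ 0 := by
  have h : zc (1 - a) (sectionFlat a y) ≠ 0 := proj_mem_chartSource.1 hy
  have h1 : (1 - a : Fin 2) ≠ a := by fin_cases a <;> simp
  simp only [sectionFlat, zc_ofZW, if_neg h1] at h
  exact left_ne_zero_of_mul h

/-- The charts make the quotient a smooth manifold of real dimension four. -/
instance : IsManifold 𝓘(ℝ, ℂ × ℂ) ∞ Space := by
  apply isManifold_of_contDiffOn
  rintro _ _ ⟨a, rfl⟩ ⟨b, rfl⟩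
  simp only [modelWithCornersSelf_coe, modelWithCornersSelf_coe_symm, Function.comp_id,
    Function.id_comp, Set.preimage_id, Set.range_id, Set.inter_univ]
  by_cases hb : b = a
  · subst hb
    refine contDiffOn_id.congr fun y hy => ?_
    exact (chart b).right_inv (Set.mem_univ _)
  · have : b = 1 - a := by fin_cases a <;> fin_cases b <;> simp at hb ⊢
    subst this
    have h1 : ∀ y ∈ ((chart a).symm.trans (chart (1 - a))).source, y.1 ≠ 0 := fun y hy =>
      ne_zero_of_mem a hy.2
    have h2 : ContDiffOn ℝ ∞ (fun y : ℂ × ℂ => ((y.1)⁻¹, -(y.1 ^ 2 * y.2)))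
        ((chart a).symm.trans (chart (1 - a))).source :=
      (contDiffOn_fst.inv h1).prodMk ((contDiffOn_fst.pow 2).mul contDiffOn_snd).neg
    exact h2.congr fun y hy => chart_symm_trans a (h1 y hy)

/-! ### The quotient metric and complex structure -/

/-- The horizontal space at `p`: the tangent vectors of `μ⁻¹(i/2)` at `p`, that is, the kernel of
the derivative of `μ`, that are orthogonal to the tangent vector `(p₀ i, p₁ i)` of the orbit. -/
def horizontal (p : LevelSet) : Submodule ℝ Flat where
  carrier := {ξ | fderiv ℝ momentMap p.1 ξ = 0 ∧ flatInner ξ (fun a => p.1 a * qi) = 0}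
  zero_mem' := by simp [flatInner]
  add_mem' := by
    rintro ξ η ⟨h1, h2⟩ ⟨h3, h4⟩
    refine ⟨by rw [map_add, h1, h3, add_zero], ?_⟩
    simp only [flatInner, Pi.add_apply, inner_add_left, Finset.sum_add_distrib] at h2 h4 ⊢
    rw [h2, h4, add_zero]
  smul_mem' := by
    rintro c ξ ⟨h1, h2⟩
    refine ⟨by rw [map_smul, h1, smul_zero], ?_⟩
    simp only [flatInner, Pi.smul_apply, real_inner_smul_left, ← Finset.mul_sum] at h2 ⊢
    rw [h2, mul_zero]

lemma fderiv_momentMap (p ξ : Flat) : fderiv ℝ momentMap p ξ =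
    (1 / 2 : ℝ) • ∑ a, (p a * qi * star (ξ a) + ξ a * qi * star (p a)) := by
  have h1 : ∀ a, HasFDerivAt (fun q : Flat => q a)
      (ContinuousLinearMap.proj (R := ℝ) (φ := fun _ : Fin 2 => ℍ[ℝ]) a) p :=
    fun a => (ContinuousLinearMap.proj (R := ℝ) (φ := fun _ : Fin 2 => ℍ[ℝ]) a).hasFDerivAt
  let S : ℍ[ℝ] →ₗ[ℝ] ℍ[ℝ] :=
    { toFun := star
      map_add' := star_add
      map_smul' := fun c q => by ext <;> simp }
  have h2 : ∀ a, HasFDerivAt (fun q : Flat => star (q a)) ((LinearMap.toContinuousLinearMap S).comp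
      (ContinuousLinearMap.proj (R := ℝ) (φ := fun _ : Fin 2 => ℍ[ℝ]) a)) p :=
    fun a => ((LinearMap.toContinuousLinearMap S).comp (ContinuousLinearMap.proj (R := ℝ)
      (φ := fun _ : Fin 2 => ℍ[ℝ]) a)).hasFDerivAt
  have h3 := (HasFDerivAt.fun_sum (u := Finset.univ)
    fun a _ => ((h1 a).mul_const' qi).mul' (h2 a)).const_smul (1 / 2 : ℝ)
  have h4 : fderiv ℝ momentMap p = _ := h3.fderiv
  rw [h4]
  simp [S]

lemma mem_horizontal_iff (p : LevelSet) (ξ : Flat) : ξ ∈ horizontal p ↔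
    (zc 0 ξ * conj (zc 0 p.1) + zc 1 ξ * conj (zc 1 p.1)
        - wc 0 ξ * conj (wc 0 p.1) - wc 1 ξ * conj (wc 1 p.1) = 0 ∧
      zc 0 ξ * wc 0 p.1 + zc 1 ξ * wc 1 p.1 + wc 0 ξ * zc 0 p.1 + wc 1 ξ * zc 1 p.1 = 0) := by
  change (fderiv ℝ momentMap p.1 ξ = 0 ∧ flatInner ξ (fun a => p.1 a * qi) = 0) ↔ _
  rw [fderiv_momentMap]
  simp only [flatInner, Fin.sum_univ_two, zc_apply, wc_apply, Quaternion.inner_def]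
  constructor
  · rintro ⟨h, h0⟩
    have h1 := congrArg QuaternionAlgebra.imI h
    have h2 := congrArg QuaternionAlgebra.imJ h
    have h3 := congrArg QuaternionAlgebra.imK h
    simp at h0 h1 h2 h3
    constructor <;> apply Complex.ext <;> simp <;> linarith
  · rintro ⟨h1, h2⟩
    have h0 := congrArg Complex.re h1
    have h0' := congrArg Complex.im h1
    have h3 := congrArg Complex.re h2
    have h4 := congrArg Complex.im h2
    simp at h0 h0' h3 h4
    constructor
    · ext <;> simp <;> linarith
    · simp
      linarith

/-- The derivative of the projection at a point `p` over `x`, with values in the tangent space of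
the quotient at `x`. In Mathlib the latter is the model space `ℂ²`, a tangent vector being
represented by its coordinates in the preferred chart at `x`; the projection followed by this
chart is the restriction of `coord (chartIndex x)` to `μ⁻¹(i/2)`. -/
def projDeriv (x : Space) (p : LevelSet) : Flat →L[ℝ] TangentSpace 𝓘(ℝ, ℂ × ℂ) x :=
  (fderiv ℝ (coord (chartIndex x)) p.1 : Flat →L[ℝ] ℂ × ℂ)

lemma fderiv_coord (a : Fin 2) (p : Flat) (h : zc a p ≠ 0) :
    DifferentiableAt ℝ (coord a) p ∧ ∀ ξ, fderiv ℝ (coord a) p ξ =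
      ((zc (1 - a) ξ * zc a p - zc (1 - a) p * zc a ξ) / zc a p ^ 2,
        zc a ξ * wc (1 - a) p + zc a p * wc (1 - a) ξ) := by
  have h1 := ((zc (1 - a)).hasFDerivAt (x := p)).mul ((hasFDerivAt_inv' h).comp p
    ((zc a).hasFDerivAt (x := p)))
  have h2 := ((zc a).hasFDerivAt (x := p)).mul ((wc (1 - a)).hasFDerivAt (x := p))
  have h3 : HasFDerivAt (coord a) _ p := h1.prodMk h2
  refine ⟨h3.differentiableAt, fun ξ => ?_⟩
  rw [h3.fderiv]
  refine Prod.ext ?_ ?_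
  · simp
    field_simp
    ring
  · simp
    ring

lemma zc_ne_zero_of_proj {x : Space} {p : LevelSet} (hp : proj p = x) :
    zc (chartIndex x) p.1 ≠ 0 := by
  have := mem_chartSource_chartIndex x
  rw [← hp, proj_mem_chartSource, hp] at this
  exact this

lemma projDeriv_apply {x : Space} {p : LevelSet} (hp : proj p = x) (ξ : Flat) :
    projDeriv x p ξ =
      ((zc (1 - chartIndex x) ξ * zc (chartIndex x) p.1
          - zc (1 - chartIndex x) p.1 * zc (chartIndex x) ξ) / zc (chartIndex x) p.1 ^ 2,
        zc (chartIndex x) ξ * wc (1 - chartIndex x) p.1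
          + zc (chartIndex x) p.1 * wc (1 - chartIndex x) ξ) :=
  (fderiv_coord (chartIndex x) p.1 (zc_ne_zero_of_proj hp)).2 ξ

/-- `projDeriv` is the derivative of the projection: it maps the velocity of a curve in
`μ⁻¹(i/2)` to the velocity of the projected curve. -/
lemma hasMFDerivAt_proj_comp (γ : ℝ → LevelSet) (ξ : Flat)
    (h : HasDerivAt (fun t => (γ t).1) ξ 0) :
    HasMFDerivAt 𝓘(ℝ, ℝ) 𝓘(ℝ, ℂ × ℂ) (fun t => proj (γ t)) 0
      (ContinuousLinearMap.toSpanSingleton ℝ (projDeriv (proj (γ 0)) (γ 0) ξ)) := by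
  constructor
  · exact continuous_proj.continuousAt.comp
      (Topology.IsInducing.subtypeVal.continuousAt_iff.2 h.continuousAt)
  · have h0 := (fderiv_coord (chartIndex (proj (γ 0))) (γ 0).1
      (zc_ne_zero_of_proj rfl)).1.hasFDerivAt
    have h1 := HasFDerivAt.comp_hasDerivAt (f := fun t => (γ t).1) (0 : ℝ) h0 h
    exact h1.hasFDerivAt.hasFDerivWithinAt

lemma projDeriv_bijective {x : Space} {p : LevelSet} (hp : proj p = x) :
    Function.Bijective ((projDeriv x p).toLinearMap.domRestrict (horizontal p)) := by
  obtain ⟨h1, h2⟩ := (momentMap_eq_iff p.1).1 p.2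
  have hz := zc_ne_zero_of_proj hp
  have hN : zc 0 p.1 * conj (zc 0 p.1) + zc 1 p.1 * conj (zc 1 p.1)
      + wc 0 p.1 * conj (wc 0 p.1) + wc 1 p.1 * conj (wc 1 p.1) ≠ 0 := by
    simp only [Complex.mul_conj] at h1 ⊢
    norm_cast at h1 ⊢
    have := Complex.normSq_nonneg (wc 0 p.1)
    have := Complex.normSq_nonneg (wc 1 p.1)
    linarith
  constructor
  · rw [injective_iff_map_eq_zero]
    rintro ⟨ξ, hξ⟩ h0
    obtain ⟨h3, h4⟩ := (mem_horizontal_iff p ξ).1 hξ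
    have h5 : projDeriv x p ξ = 0 := h0
    rw [projDeriv_apply hp] at h5
    obtain ⟨h6, h7⟩ := Prod.ext_iff.1 (show (_ : ℂ × ℂ) = (0 : ℂ × ℂ) from h5)
    refine Subtype.ext ?_
    change ξ = 0
    suffices h8 : (zc 0 ξ = 0 ∧ zc 1 ξ = 0) ∧ wc 0 ξ = 0 ∧ wc 1 ξ = 0 by
      apply flat_ext <;> intro a <;> fin_cases a <;> simp [h8]
    clear hξ h0 h5
    generalize chartIndex x = k at *
    obtain rfl | rfl : k = 0 ∨ k = 1 := by fin_cases k <;> simp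
    · simp only [show (1 - 0 : Fin 2) = 1 from rfl, Prod.fst_zero, Prod.snd_zero] at h6 h7
      rw [div_eq_zero_iff, or_iff_left (pow_ne_zero 2 hz)] at h6
      obtain ⟨c, hc⟩ : ∃ c, c = zc 0 ξ / zc 0 p.1 := ⟨_, rfl⟩
      have e0 : zc 0 ξ = c * zc 0 p.1 := by rw [hc]; field_simp
      have e1 : zc 1 ξ = c * zc 1 p.1 :=
        mul_right_cancel₀ hz (by linear_combination h6 + zc 1 p.1 * e0)
      have e3 : wc 1 ξ = -(c * wc 1 p.1) :=
        mul_right_cancel₀ hz (by linear_combination h7 - wc 1 p.1 * e0)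
      have e2 : wc 0 ξ = -(c * wc 0 p.1) := mul_right_cancel₀ hz (by
        linear_combination h4 - wc 0 p.1 * e0 - wc 1 p.1 * e1 - zc 1 p.1 * e3)
      have hc0 : c = 0 := (mul_eq_zero.1 (by
        rw [e0, e1, e2, e3] at h3
        linear_combination h3 : c * _ = 0)).resolve_right hN
      simp [e0, e1, e2, e3, hc0]
    · simp only [show (1 - 1 : Fin 2) = 0 from rfl, Prod.fst_zero, Prod.snd_zero] at h6 h7
      rw [div_eq_zero_iff, or_iff_left (pow_ne_zero 2 hz)] at h6
      obtain ⟨c, hc⟩ : ∃ c, c = zc 1 ξ / zc 1 p.1 := ⟨_, rfl⟩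
      have e1 : zc 1 ξ = c * zc 1 p.1 := by rw [hc]; field_simp
      have e0 : zc 0 ξ = c * zc 0 p.1 :=
        mul_right_cancel₀ hz (by linear_combination h6 + zc 0 p.1 * e1)
      have e2 : wc 0 ξ = -(c * wc 0 p.1) :=
        mul_right_cancel₀ hz (by linear_combination h7 - wc 0 p.1 * e1)
      have e3 : wc 1 ξ = -(c * wc 1 p.1) := mul_right_cancel₀ hz (by
        linear_combination h4 - wc 0 p.1 * e0 - wc 1 p.1 * e1 - zc 0 p.1 * e2)
      have hc0 : c = 0 := (mul_eq_zero.1 (by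
        rw [e0, e1, e2, e3] at h3
        linear_combination h3 : c * _ = 0)).resolve_right hN
      simp [e0, e1, e2, e3, hc0]
  · rintro ⟨u, v⟩
    suffices h8 : ∃ ξ ∈ horizontal p, projDeriv x p ξ = (u, v) by
      obtain ⟨ξ, hξ, h⟩ := h8
      exact ⟨⟨ξ, hξ⟩, h⟩
    simp only [mem_horizontal_iff, projDeriv_apply hp]
    generalize chartIndex x = k at *
    obtain ⟨N, hNdef⟩ : ∃ N, zc 0 p.1 * conj (zc 0 p.1) + zc 1 p.1 * conj (zc 1 p.1)
      + wc 0 p.1 * conj (wc 0 p.1) + wc 1 p.1 * conj (wc 1 p.1) = N := ⟨_, rfl⟩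
    rw [hNdef] at hN
    obtain rfl | rfl : k = 0 ∨ k = 1 := by fin_cases k <;> simp
    · simp only [show (1 - 0 : Fin 2) = 1 from rfl]
      obtain ⟨r, hr⟩ : ∃ r, r = -((zc 0 p.1 * u * wc 1 p.1 + v / zc 0 p.1 * zc 1 p.1) / zc 0 p.1) := ⟨_, rfl⟩
      obtain ⟨c, hc⟩ : ∃ c, c = -((zc 0 p.1 * u * conj (zc 1 p.1) - r * conj (wc 0 p.1)
          - v / zc 0 p.1 * conj (wc 1 p.1)) / N) := ⟨_, rfl⟩
      have hr' : r * zc 0 p.1 = -(zc 0 p.1 * u * wc 1 p.1 + v / zc 0 p.1 * zc 1 p.1) := by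
        rw [hr]
        field_simp
      have hc' : c * N = -(zc 0 p.1 * u * conj (zc 1 p.1) - r * conj (wc 0 p.1)
          - v / zc 0 p.1 * conj (wc 1 p.1)) := by
        rw [hc]
        field_simp
      refine ⟨ofZW ![c * zc 0 p.1, zc 0 p.1 * u + c * zc 1 p.1]
        ![r - c * wc 0 p.1, v / zc 0 p.1 - c * wc 1 p.1], ⟨?_, ?_⟩, ?_⟩
      · simp
        linear_combination hc' + c * hNdef
      · simp
        linear_combination hr'
      · refine Prod.ext ?_ ?_
        · simp
          field_simp
          ring
        · simp
          field_simp
          ring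
    · simp only [show (1 - 1 : Fin 2) = 0 from rfl]
      obtain ⟨r, hr⟩ : ∃ r, r = -((zc 1 p.1 * u * wc 0 p.1 + v / zc 1 p.1 * zc 0 p.1) / zc 1 p.1) := ⟨_, rfl⟩
      obtain ⟨c, hc⟩ : ∃ c, c = -((zc 1 p.1 * u * conj (zc 0 p.1) - r * conj (wc 1 p.1)
          - v / zc 1 p.1 * conj (wc 0 p.1)) / N) := ⟨_, rfl⟩
      have hr' : r * zc 1 p.1 = -(zc 1 p.1 * u * wc 0 p.1 + v / zc 1 p.1 * zc 0 p.1) := by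
        rw [hr]
        field_simp
      have hc' : c * N = -(zc 1 p.1 * u * conj (zc 0 p.1) - r * conj (wc 1 p.1)
          - v / zc 1 p.1 * conj (wc 0 p.1)) := by
        rw [hc]
        field_simp
      refine ⟨ofZW ![zc 1 p.1 * u + c * zc 0 p.1, c * zc 1 p.1]
        ![v / zc 1 p.1 - c * wc 0 p.1, r - c * wc 1 p.1], ⟨?_, ?_⟩, ?_⟩
      · simp
        linear_combination hc' + c * hNdef
      · simp
        linear_combination hr'
      · refine Prod.ext ?_ ?_
        · simp
          field_simp
          ring
        · simp
          field_simp
          ring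

/-- The horizontal lift: the inverse of the isomorphism from the horizontal space at a point `p`
over `x` to the tangent space of the quotient at `x`. -/
def horizontalLift {x : Space} {p : LevelSet} (hp : proj p = x) :
    TangentSpace 𝓘(ℝ, ℂ × ℂ) x ≃ₗ[ℝ] horizontal p :=
  (LinearEquiv.ofBijective _ (projDeriv_bijective hp)).symm

/-- A point of `μ⁻¹(i/2)` over a given point of the quotient. -/
def pt (x : Space) : LevelSet := Function.surjInv proj_surjective x

lemma proj_pt (x : Space) : proj (pt x) = x := Function.surjInv_eq proj_surjective x

/-- The Riemannian metric of the hyperkähler quotient: the flat inner product of horizontal lifts.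
It does not depend on the point over `x`, see `metric_projDeriv`. -/
def metric (x : Space) (v w : TangentSpace 𝓘(ℝ, ℂ × ℂ) x) : ℝ :=
  flatInner (horizontalLift (proj_pt x) v).1 (horizontalLift (proj_pt x) w).1

/-- The complex structure `I` of the hyperkähler quotient (the first of the triple `I, J, K` induced
by left multiplication with `i, j, k`, corresponding to the direction of the level `i/2` of `μ`):
left multiplication with `i` on horizontal vectors, which preserves the horizontal space.
It does not depend on the point over `x`, see `complexStructure_projDeriv`. -/
def complexStructure (x : Space) (v : TangentSpace 𝓘(ℝ, ℂ × ℂ) x) :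
    TangentSpace 𝓘(ℝ, ℂ × ℂ) x :=
  projDeriv x (pt x) (fun a => qi * (horizontalLift (proj_pt x) v).1 a)

lemma smul_mem_horizontal (t : Circle) (p : LevelSet) {ξ : Flat} (hξ : ξ ∈ horizontal p) :
    (fun a => ξ a * ((t : ℂ) : ℍ[ℝ])) ∈ horizontal (t • p) := by
  have ht := circle_mul_conj t
  obtain ⟨h1, h2⟩ := (mem_horizontal_iff p ξ).1 hξ
  rw [mem_horizontal_iff]
  simp only [zc_mul_right, wc_mul_right, zc_smul, wc_smul, map_mul, Complex.conj_conj]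
  constructor
  · linear_combination (t : ℂ) * conj (t : ℂ) * h1
  · linear_combination (t : ℂ) * conj (t : ℂ) * h2

lemma projDeriv_smul {x : Space} {p : LevelSet} (hp : proj p = x) (t : Circle) (ξ : Flat) :
    projDeriv x (t • p) (fun a => ξ a * ((t : ℂ) : ℍ[ℝ])) = projDeriv x p ξ := by
  have ht := circle_mul_conj t
  have ht0 : (t : ℂ) ≠ 0 := t.coe_ne_zero
  have hp' : proj (t • p) = x := by
    rw [← hp]
    exact proj_eq_iff.2 ⟨t, rfl⟩
  have hz := zc_ne_zero_of_proj hp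
  rw [projDeriv_apply hp, projDeriv_apply hp']
  simp only [zc_mul_right, wc_mul_right, zc_smul, wc_smul]
  refine Prod.ext ?_ ?_
  · dsimp only
    field_simp
  · dsimp only
    linear_combination (zc (chartIndex x) ξ * wc (1 - chartIndex x) p.1
          + zc (chartIndex x) p.1 * wc (1 - chartIndex x) ξ) * ht

lemma horizontalLift_pt (p : LevelSet) : ∃ t : Circle, t • p = pt (proj p) ∧
    ∀ ξ ∈ horizontal p, (horizontalLift (proj_pt (proj p)) (projDeriv (proj p) p ξ)).1
        = fun a => ξ a * ((t : ℂ) : ℍ[ℝ]) := by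
  obtain ⟨t, ht⟩ := proj_eq_iff.1 (proj_pt (proj p))
  refine ⟨t, ht, fun ξ hξ => ?_⟩
  have h1 : (fun a => ξ a * ((t : ℂ) : ℍ[ℝ])) ∈ horizontal (pt (proj p)) := by
    rw [← ht]
    exact smul_mem_horizontal t p hξ
  have h2 : horizontalLift (proj_pt (proj p)) (projDeriv (proj p) p ξ) = ⟨_, h1⟩ := by
    unfold horizontalLift
    rw [LinearEquiv.symm_apply_eq]
    change _ = projDeriv (proj p) (pt (proj p)) _
    rw [← projDeriv_smul rfl t ξ, ht]
    rfl
  rw [h2]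

lemma flatInner_mul_right (t : Circle) (ξ η : Flat) :
    flatInner (fun a => ξ a * ((t : ℂ) : ℍ[ℝ])) (fun a => η a * ((t : ℂ) : ℍ[ℝ]))
      = flatInner ξ η := by
  have h1 : star ((t : ℂ) : ℍ[ℝ]) = ((conj (t : ℂ) : ℂ) : ℍ[ℝ]) := by ext <;> simp
  have h2 : ((t : ℂ) : ℍ[ℝ]) * star ((t : ℂ) : ℍ[ℝ]) = 1 := by
    rw [h1, ← Quaternion.coeComplex_mul, circle_mul_conj, Quaternion.coeComplex_one]
  unfold flatInner
  refine Finset.sum_congr rfl fun a _ => ?_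
  rw [Quaternion.inner_def, Quaternion.inner_def, star_mul, mul_assoc, ← mul_assoc _ _ (star (η a)),
    h2, one_mul]

/-- The projection is a Riemannian submersion. -/
lemma metric_projDeriv (p : LevelSet) {ξ η : Flat} (hξ : ξ ∈ horizontal p)
    (hη : η ∈ horizontal p) :
    metric (proj p) (projDeriv (proj p) p ξ) (projDeriv (proj p) p η) = flatInner ξ η := by
  obtain ⟨t, -, h⟩ := horizontalLift_pt p
  unfold metric
  rw [h ξ hξ, h η hη, flatInner_mul_right]

/-- The complex structure is induced by left multiplication with `i` at every point. -/
lemma complexStructure_projDeriv (p : LevelSet) {ξ : Flat} (hξ : ξ ∈ horizontal p) :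
    complexStructure (proj p) (projDeriv (proj p) p ξ)
      = projDeriv (proj p) p (fun a => qi * ξ a) := by
  obtain ⟨t, ht, h⟩ := horizontalLift_pt p
  unfold complexStructure
  rw [h ξ hξ, ← projDeriv_smul rfl t (fun a => qi * ξ a), ht]
  simp only [mul_assoc]

/-- A map of the quotient to itself preserves the Riemannian metric. -/
def PreservesMetric (φ : Space → Space) : Prop :=
  ∀ (x : Space) (v w : TangentSpace 𝓘(ℝ, ℂ × ℂ) x),
    metric (φ x) (mfderiv 𝓘(ℝ, ℂ × ℂ) 𝓘(ℝ, ℂ × ℂ) φ x v) (mfderiv 𝓘(ℝ, ℂ × ℂ) 𝓘(ℝ, ℂ × ℂ) φ x w)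
      = metric x v w

/-- The derivative of a map of the quotient to itself commutes with the complex structure. -/
def IsHolomorphic (φ : Space → Space) : Prop :=
  ∀ (x : Space) (v : TangentSpace 𝓘(ℝ, ℂ × ℂ) x),
    mfderiv 𝓘(ℝ, ℂ × ℂ) 𝓘(ℝ, ℂ × ℂ) φ x (complexStructure x v)
      = complexStructure (φ x) (mfderiv 𝓘(ℝ, ℂ × ℂ) 𝓘(ℝ, ℂ × ℂ) φ x v)

/-- The group of holomorphic isometries of Eguchi–Hanson space: diffeomorphisms that preserve the
Riemannian metric and the complex structure. -/
def holomorphicIsometryGroup : Subgroup (Space ≃ₜ Space) where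
  carrier := {φ | ContMDiff 𝓘(ℝ, ℂ × ℂ) 𝓘(ℝ, ℂ × ℂ) ∞ φ ∧
    ContMDiff 𝓘(ℝ, ℂ × ℂ) 𝓘(ℝ, ℂ × ℂ) ∞ φ.symm ∧ PreservesMetric φ ∧ IsHolomorphic φ}
  one_mem' := by
    have h : ∀ x, mfderiv 𝓘(ℝ, ℂ × ℂ) 𝓘(ℝ, ℂ × ℂ) (fun y : Space => y) x
        = ContinuousLinearMap.id ℝ _ := fun x => mfderiv_id
    refine ⟨contMDiff_id, contMDiff_id, fun x v w => ?_, fun x v => ?_⟩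
    · change metric x (mfderiv 𝓘(ℝ, ℂ × ℂ) 𝓘(ℝ, ℂ × ℂ) (fun y : Space => y) x v)
        (mfderiv 𝓘(ℝ, ℂ × ℂ) 𝓘(ℝ, ℂ × ℂ) (fun y : Space => y) x w) = _
      rw [h]
      rfl
    · change mfderiv 𝓘(ℝ, ℂ × ℂ) 𝓘(ℝ, ℂ × ℂ) (fun y : Space => y) x _ =
        complexStructure x (mfderiv 𝓘(ℝ, ℂ × ℂ) 𝓘(ℝ, ℂ × ℂ) (fun y : Space => y) x v)
      rw [h]
      rfl
  mul_mem' := by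
    rintro φ ψ ⟨h1, h2, h3, h4⟩ ⟨k1, k2, k3, k4⟩
    have h : ∀ x, mfderiv 𝓘(ℝ, ℂ × ℂ) 𝓘(ℝ, ℂ × ℂ) (φ ∘ ψ) x
        = (mfderiv 𝓘(ℝ, ℂ × ℂ) 𝓘(ℝ, ℂ × ℂ) φ (ψ x)).comp
          (mfderiv 𝓘(ℝ, ℂ × ℂ) 𝓘(ℝ, ℂ × ℂ) ψ x) := fun x =>
      mfderiv_comp x (h1.mdifferentiable (by simp) _) (k1.mdifferentiable (by simp) _)
    refine ⟨h1.comp k1, k2.comp h2, fun x v w => ?_, fun x v => ?_⟩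
    · change metric (φ (ψ x)) (mfderiv 𝓘(ℝ, ℂ × ℂ) 𝓘(ℝ, ℂ × ℂ) (φ ∘ ψ) x v)
        (mfderiv 𝓘(ℝ, ℂ × ℂ) 𝓘(ℝ, ℂ × ℂ) (φ ∘ ψ) x w) = _
      rw [h]
      exact (h3 _ _ _).trans (k3 _ _ _)
    · change mfderiv 𝓘(ℝ, ℂ × ℂ) 𝓘(ℝ, ℂ × ℂ) (φ ∘ ψ) x _ =
        complexStructure (φ (ψ x)) (mfderiv 𝓘(ℝ, ℂ × ℂ) 𝓘(ℝ, ℂ × ℂ) (φ ∘ ψ) x v)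
      rw [h]
      exact (congrArg _ (k4 x v)).trans (h4 _ _)
  inv_mem' := by
    rintro φ ⟨h1, h2, h3, h4⟩
    have h : ∀ x v, mfderiv 𝓘(ℝ, ℂ × ℂ) 𝓘(ℝ, ℂ × ℂ) φ.symm (φ x)
        (mfderiv 𝓘(ℝ, ℂ × ℂ) 𝓘(ℝ, ℂ × ℂ) φ x v) = v := fun x v => by
      have e := mfderiv_comp x (h2.mdifferentiable (by simp) (φ x))
        (h1.mdifferentiable (by simp) x)
      have e' : φ.symm ∘ φ = id := φ.symm_comp_self
      rw [e', mfderiv_id] at e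
      exact (congrArg (fun f => f v) e).symm
    have hs : ∀ x (v : TangentSpace 𝓘(ℝ, ℂ × ℂ) (φ x)),
        ∃ w, mfderiv 𝓘(ℝ, ℂ × ℂ) 𝓘(ℝ, ℂ × ℂ) φ x w = v := fun x => by
      let A : (ℂ × ℂ) →ₗ[ℝ] (ℂ × ℂ) :=
        (mfderiv 𝓘(ℝ, ℂ × ℂ) 𝓘(ℝ, ℂ × ℂ) φ x : (ℂ × ℂ) →L[ℝ] (ℂ × ℂ)).toLinearMap
      have hA : Function.Injective A := Function.LeftInverse.injective (h x)
      have hA' : Function.Surjective A := LinearMap.injective_iff_surjective.1 hA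
      exact hA'
    refine ⟨h2, h1, fun x v w => ?_, fun x v => ?_⟩
    · have key : ∀ y z, z = y → ∀ v w : ℂ × ℂ, metric z v w = metric y v w := by
        rintro y _ rfl v w
        rfl
      obtain ⟨y, rfl⟩ := φ.surjective x
      obtain ⟨v, rfl⟩ := hs y v
      obtain ⟨w, rfl⟩ := hs y w
      refine (key y _ (φ.symm_apply_apply y) _ _).trans ?_
      refine Eq.trans ?_ (h3 y v w).symm
      exact congrArg₂ (metric y) (h y v) (h y w)
    · have key : ∀ y z, z = y → ∀ v : ℂ × ℂ, complexStructure z v = complexStructure y v := by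
        rintro y _ rfl v
        rfl
      obtain ⟨y, rfl⟩ := φ.surjective x
      obtain ⟨v, rfl⟩ := hs y v
      refine Eq.trans ?_ (key y _ (φ.symm_apply_apply y) _).symm
      refine (congrArg _ (h4 y v).symm).trans ((h y _).trans ?_)
      exact congrArg (complexStructure y) (h y v).symm

/-! ### The groups -/

/-- The subgroup `{±1}` of `U(2)`. -/
def pmOne : Subgroup (Matrix.unitaryGroup (Fin 2) ℂ) where
  carrier := {1, -1}
  one_mem' := Or.inl rfl
  mul_mem' := by
    rintro _ _ (rfl | rfl) (rfl | rfl) <;> simp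
  inv_mem' := by
    rintro _ (rfl | rfl) <;> simp

instance : pmOne.Normal where
  conj_mem := by
    rintro _ (rfl | rfl) g
    · simp
    · have : g * -1 * g⁻¹ = -1 := by simp
      rw [this]
      exact Or.inr rfl

/-- The element `λ A` of `U(2)` for `λ ∈ U(1)` and `A ∈ SU(2)`. -/
def scale (t : Circle) (A : Matrix.specialUnitaryGroup (Fin 2) ℂ) :
    Matrix.unitaryGroup (Fin 2) ℂ :=
  ⟨(t : ℂ) • (A : Matrix (Fin 2) (Fin 2) ℂ), by
    have hA := Matrix.mem_unitaryGroup_iff.1 (Matrix.specialUnitaryGroup_le_unitaryGroup A.2)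
    rw [Matrix.mem_unitaryGroup_iff, star_smul, smul_mul_smul_comm, hA]
    change ((t : ℂ) * conj (t : ℂ)) • (1 : Matrix (Fin 2) (Fin 2) ℂ) = 1
    rw [circle_mul_conj, one_smul]⟩

end EguchiHanson

end

/-! Write `qₐ = zₐ + wₐ j`. As a complex manifold the quotient is the cotangent bundle of the
projective line: the zero section is `w = 0`, and the two charts are glued by `(u, v) ↦ (u⁻¹, -u²
v)`. The maps `q ↦ λ q A` are linear isometries of `ℍ²` that commute with the circle acting from the
right and with left multiplication by `i`, so they descend to holomorphic isometries. Both this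
action and the surjection `(λ, A) ↦ [λ A]` onto `U(2) / {±1}` have kernel `{±1} × {±1}`. The
isomorphism then follows from the first isomorphism theorem once the action is known to exhaust the
group, which is `isometryAction_surjective`.

For that, let `φ` be a holomorphic isometry. The functions `z_a w_b` are holomorphic on the whole
quotient and separate points off the zero section. The zero section minus a point is a copy of `ℂ`;
on it the functions `z_a w_b ∘ φ` are entire and bounded by compactness, hence constant by
Liouville. If the image left the zero section, `φ` would not be injective (`invariant_eq_zero`).
Since `SU(2)` is transitive on the zero section, `φ` may be assumed to fix a base point. Its
derivative there is unitary and preserves the tangent line of the zero section, so it is `diag(α,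
β)`, and the maximal torus of `U(1) × SU(2)` contains an element with the inverse derivative.

What remains is rigidity: a holomorphic isometry equal to the identity to first order at the base
point is the identity. Locally this is proved without geodesics
(`eventually_eq_self_of_preserves_metric`): the leading coefficient of `df - id` along a complex
line, multiplied by any unit complex number, is skew for the Hermitian metric at the origin. A
complex linear map `F` with both `F` and `iF` skew vanishes. The passage from local to global
(`eq_self_of_fderiv_eq`) uses the identity theorem for `z_a w_b ∘ φ` on complex lines of a chart,
and density. -/

noncomputable section

namespace EguchiHanson

open scoped Quaternion Manifold ContDiff Matrix ComplexConjugate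

open Filter Topology

/-! ### Holomorphic maps between complex normed spaces -/

section Holomorphic

variable {E F : Type*} [NormedAddCommGroup E] [NormedSpace ℂ E] [NormedAddCommGroup F]
  [NormedSpace ℂ F]

/-- The complex linear map underlying a real linear map that commutes with `i`. -/
def complexLinear (T : E →L[ℝ] F) (hT : ∀ v, T (Complex.I • v) = Complex.I • T v) : E →L[ℂ] F where
  toFun := T
  map_add' := map_add T
  map_smul' c v := by
    rw [RingHom.id_apply, ← Complex.re_add_im c]
    simp only [add_smul, mul_smul, Complex.coe_smul, map_add, map_smul, hT]
  cont := T.continuous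

lemma differentiableAt_complex {f : E → F} {x : E} (hf : DifferentiableAt ℝ f x)
    (h : ∀ v, fderiv ℝ f x (Complex.I • v) = Complex.I • fderiv ℝ f x v) :
    DifferentiableAt ℂ f x :=
  (differentiableAt_iff_restrictScalars ℝ hf).2 ⟨complexLinear _ h, rfl⟩

lemma fderiv_real_eq {f : E → F} {x : E} (hf : DifferentiableAt ℂ f x) (v : E) :
    fderiv ℝ f x v = fderiv ℂ f x v := by
  rw [hf.fderiv_restrictScalars ℝ]
  rfl

/-- A basis of `E` identifies `E →L[ℂ] F` with a finite power of `F`, where differentiability is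
checked componentwise. -/
lemma differentiableAt_of_forall_apply [FiniteDimensional ℂ E] {H : Type*} [NormedAddCommGroup H]
    [NormedSpace ℂ H] {f : H → E →L[ℂ] F} {x : H}
    (h : ∀ v, DifferentiableAt ℂ (fun y => f y v) x) : DifferentiableAt ℂ f x := by
  let e₁ : E ≃L[ℂ] (Fin (Module.finrank ℂ E) → ℂ) :=
    ContinuousLinearEquiv.ofFinrankEq (Module.finrank_fin_fun ℂ).symm
  let e₂ := (e₁.arrowCongr (1 : F ≃L[ℂ] F)).trans (ContinuousLinearEquiv.piRing (Fin _))
  rw [← Function.id_comp f, ← e₂.symm_comp_self]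
  exact e₂.symm.differentiableAt.comp x (differentiableAt_pi.2 fun i => h _)

/-- The real second derivative is complex linear in the vector slot, because the first derivatives
at nearby points are. Symmetry transfers this to the slot of the direction of differentiation, which
is the Cauchy–Riemann equation for `fderiv ℂ f`. -/
lemma differentiableAt_fderiv_complex [FiniteDimensional ℂ E] {f : E → F} {x : E}
    (hf : ContDiffAt ℝ 2 f x) (h : ∀ᶠ y in 𝓝 x, DifferentiableAt ℂ f y) :
    DifferentiableAt ℂ (fderiv ℂ f) x := by
  refine differentiableAt_of_forall_apply fun w => ?_
  have hD : DifferentiableAt ℝ (fderiv ℝ f) x :=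
    (hf.fderiv_right (m := 1) (by norm_num)).differentiableAt (by norm_num)
  have hsymm : IsSymmSndFDerivAt ℝ f x := hf.isSymmSndFDerivAt (by simp)
  have happ : ∀ u v, fderiv ℝ (fun y => fderiv ℝ f y u) x v = fderiv ℝ (fderiv ℝ f) x v u := by
    intro u v
    rw [fderiv_clm_apply hD (differentiableAt_const u)]
    simp
  have heq : (fun y => fderiv ℂ f y w) =ᶠ[𝓝 x] fun y => fderiv ℝ f y w :=
    h.mono fun y hy => (fderiv_real_eq hy w).symm
  have hI : ∀ v w, fderiv ℝ (fderiv ℝ f) x w (Complex.I • v)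
      = Complex.I • fderiv ℝ (fderiv ℝ f) x w v := by
    intro v w
    have e : (fun y => fderiv ℝ f y (Complex.I • v)) =ᶠ[𝓝 x]
        fun y => Complex.I • fderiv ℝ f y v := h.mono fun y hy => by
      simp only [fderiv_real_eq hy, map_smul]
    rw [← happ, e.fderiv_eq, fderiv_fun_const_smul (hD.clm_apply (differentiableAt_const v)),
      ← happ]
    rfl
  refine DifferentiableAt.congr_of_eventuallyEq ?_ heq
  refine differentiableAt_complex (hD.clm_apply (differentiableAt_const w)) fun v => ?_
  rw [happ, happ, hsymm.eq, hI, hsymm.eq]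

/-- A function with derivative `O(ζ ^ m)` that vanishes at the origin is `O(ζ ^ (m + 1))`. -/
lemma norm_le_of_norm_deriv_le {g : ℂ → F} {g' : ℂ → F} {C : ℝ} (m : ℕ)
    (hg : ∀ᶠ ζ in 𝓝 (0 : ℂ), HasDerivAt g (g' ζ) ζ ∧ ‖g' ζ‖ ≤ C * ‖ζ‖ ^ m) (h0 : g 0 = 0) :
    ∀ᶠ ζ in 𝓝 (0 : ℂ), ‖g ζ‖ ≤ C * ‖ζ‖ ^ (m + 1) := by
  obtain ⟨ε, hε, h⟩ := Metric.eventually_nhds_iff_ball.1 hg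
  filter_upwards [Metric.ball_mem_nhds (0 : ℂ) hε] with ζ hζ
  -- `C` is not assumed nonnegative; the bound at a nonzero `ζ` forces it.
  have hC : 0 ≤ C ∨ ζ = 0 := by
    by_cases hz : ζ = 0
    · exact Or.inr hz
    · left
      by_contra! hneg
      have := (norm_nonneg _).trans (h ζ hζ).2
      have := pow_pos (norm_pos_iff.2 hz) m
      nlinarith
  rcases hC with hC | rfl
  · have hsub : Metric.closedBall (0 : ℂ) ‖ζ‖ ⊆ Metric.ball 0 ε := by
      refine Metric.closedBall_subset_ball ?_
      simpa using hζ
    have key := (convex_closedBall (0 : ℂ) ‖ζ‖).norm_image_sub_le_of_norm_hasDerivWithin_le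
      (f := g) (f' := g') (C := C * ‖ζ‖ ^ m) (x := 0) (y := ζ)
      (fun s hs => (h s (hsub hs)).1.hasDerivWithinAt)
      (fun s hs => (h s (hsub hs)).2.trans (by
        have : ‖s‖ ≤ ‖ζ‖ := by simpa using hs
        gcongr)) (by simp) (by simp)
    rw [h0, sub_zero, sub_zero] at key
    rw [pow_succ, ← mul_assoc]
    exact key
  · simp [h0]

lemma tendsto_clm_apply {𝕜 V W X : Type*} [NontriviallyNormedField 𝕜] [NormedAddCommGroup V]
    [NormedSpace 𝕜 V] [NormedAddCommGroup W] [NormedSpace 𝕜 W] {l : Filter X} {T : X → V →L[𝕜] W}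
    {x : X → V} {S : V →L[𝕜] W} {v : V} (hT : Tendsto T l (𝓝 S)) (hx : Tendsto x l (𝓝 v)) :
    Tendsto (fun r => T r (x r)) l (𝓝 (S v)) :=
  (isBoundedBilinearMap_apply.continuous.tendsto (S, v)).comp (hT.prodMk_nhds hx)

variable [FiniteDimensional ℂ E]

/-- A holomorphic map that preserves a Hermitian metric and agrees with the identity to first
order at the origin is the identity near the origin on every complex line. -/
theorem eventually_eq_self_of_preserves_metric (G : E → E →L[ℝ] E →L[ℝ] ℝ) (f : E → E)
    (hG : ContDiffAt ℝ 1 G 0) (hGI : ∀ v w, G 0 (Complex.I • v) (Complex.I • w) = G 0 v w)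
    (hG0 : ∀ v, (∀ w, G 0 v w = 0) → v = 0)
    (hf : ∀ᶠ y in 𝓝 0, ContDiffAt ℝ 2 f y ∧ DifferentiableAt ℂ f y ∧
      ∀ v w, G (f y) (fderiv ℂ f y v) (fderiv ℂ f y w) = G y v w)
    (hf0 : f 0 = 0) (hf1 : ∀ v, fderiv ℂ f 0 v = v) (y : E) :
    ∀ᶠ ζ in 𝓝 (0 : ℂ), f (ζ • y) = ζ • y := by
  have : CompleteSpace E := FiniteDimensional.complete ℂ E
  have hline : Tendsto (fun ζ : ℂ => ζ • y) (𝓝 0) (𝓝 0) := by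
    have : Continuous fun ζ : ℂ => ζ • y := by fun_prop
    simpa using this.tendsto 0
  set D : ℂ → E →L[ℂ] E := fun ζ => fderiv ℂ f (ζ • y) - ContinuousLinearMap.id ℂ E with hD
  have hlineD : ∀ ζ, DifferentiableAt ℂ (fun ζ : ℂ => ζ • y) ζ := fun ζ => by fun_prop
  have hDan : AnalyticAt ℂ D 0 := by
    rw [Complex.analyticAt_iff_eventually_differentiableAt]
    have h := (hf.eventually_nhds.mono fun z hz => differentiableAt_fderiv_complex
      hz.self_of_nhds.1 (hz.mono fun _ h => h.2.1))
    filter_upwards [hline.eventually h] with ζ hζ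
    exact (DifferentiableAt.comp (g := fderiv ℂ f) ζ hζ (hlineD ζ)).sub_const _
  have hD0 : D 0 = 0 := by
    ext1 v
    simp [hD, hf1]
  set g : ℂ → E := fun ζ => f (ζ • y) - ζ • y with hg
  have hg0 : g 0 = 0 := by simp [hg, hf0]
  have hg' : ∀ᶠ ζ in 𝓝 0, HasDerivAt g (D ζ y) ζ := by
    filter_upwards [hline.eventually hf] with ζ hζ
    have h1 : HasDerivAt (fun ζ : ℂ => ζ • y) y ζ := by
      simpa using (hasDerivAt_id ζ).smul_const y
    exact (hζ.2.1.hasFDerivAt.comp_hasDerivAt (f := fun ζ : ℂ => ζ • y) ζ h1).sub h1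
  by_cases hz : ∀ᶠ ζ in 𝓝 0, D ζ = 0
  · have h := norm_le_of_norm_deriv_le (g := g) (C := 0) 0
      ((hg'.and hz).mono fun ζ h => ⟨h.1, by simp [h.2]⟩) hg0
    filter_upwards [h] with ζ hζ
    rw [zero_mul, norm_le_zero_iff, hg] at hζ
    exact sub_eq_zero.1 hζ
  exfalso
  -- `D ζ = ζ ^ m • F ζ` with `F 0 ≠ 0` the leading coefficient; the rest of the proof shows `F 0 =
  -- 0`.
  obtain ⟨m, F, hF, hF0, hDF⟩ := hDan.exists_eventuallyEq_pow_smul_nonzero_iff.2 hz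
  simp only [sub_zero] at hDF
  have hm : m ≠ 0 := by
    rintro rfl
    have := hDF.self_of_nhds
    simp [hD0] at this
    exact hF0 this.symm
  obtain ⟨C, hC0, hC⟩ : ∃ C, 0 ≤ C ∧ ∀ᶠ ζ in 𝓝 0, ‖g ζ‖ ≤ C * ‖ζ‖ ^ (m + 1) := by
    refine ⟨(‖F 0‖ + 1) * ‖y‖, by positivity, norm_le_of_norm_deriv_le
      (g' := fun ζ => D ζ y) m ?_ hg0⟩
    have hb : ∀ᶠ ζ in 𝓝 0, ‖F ζ‖ < ‖F 0‖ + 1 :=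
      hF.continuousAt.norm.eventually (gt_mem_nhds (by linarith))
    filter_upwards [hg', hDF, hb] with ζ h1 h2 h3
    refine ⟨h1, ?_⟩
    rw [h2]
    calc ‖(ζ ^ m • F ζ) y‖ ≤ ‖ζ ^ m • F ζ‖ * ‖y‖ := ContinuousLinearMap.le_opNorm _ _
      _ ≤ (‖ζ‖ ^ m * (‖F 0‖ + 1)) * ‖y‖ := by
        rw [norm_smul, norm_pow]
        gcongr
      _ = _ := by ring
  obtain ⟨K, s, hs, hK⟩ := hG.exists_lipschitzOnWith
  have hfline : Tendsto (fun ζ : ℂ => f (ζ • y)) (𝓝 0) (𝓝 0) := by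
    have h := hf.self_of_nhds.2.1.continuousAt.tendsto.comp hline
    rwa [hf0] at h
  -- Invariance of the metric at `ζ = r c`, with `df = id + r ^ m c ^ m F`, divided by `r ^ m` in
  -- the limit `r → 0+`: every `c ^ m • F 0` is skew for `G 0`.
  have key : ∀ c : ℂ, ‖c‖ = 1 → ∀ v w, G 0 (c ^ m • F 0 v) w + G 0 v (c ^ m • F 0 w) = 0 := by
    intro c hc v w
    have hr : Tendsto (fun r : ℝ => (r : ℂ) * c) (𝓝[>] 0) (𝓝 0) := by
      have : Continuous fun r : ℝ => (r : ℂ) * c := by fun_prop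
      simpa using (this.tendsto 0).mono_left nhdsWithin_le_nhds
    have hGf : Tendsto (fun r : ℝ => G (f (((r : ℂ) * c) • y))) (𝓝[>] 0) (𝓝 (G 0)) :=
      hG.continuousAt.tendsto.comp (hfline.comp hr)
    have hFv : ∀ v, Tendsto (fun r : ℝ => c ^ m • F ((r : ℂ) * c) v) (𝓝[>] 0)
        (𝓝 (c ^ m • F 0 v)) := fun v =>
      (tendsto_clm_apply (hF.continuousAt.tendsto.comp hr) tendsto_const_nhds).const_smul _
    have t1 := tendsto_clm_apply (tendsto_clm_apply hGf (hFv v)) (tendsto_const_nhds (x := w))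
    have t2 := tendsto_clm_apply (tendsto_clm_apply hGf (tendsto_const_nhds (x := v))) (hFv w)
    have t3 := tendsto_clm_apply (tendsto_clm_apply hGf (hFv v)) (hFv w)
    have tr : Tendsto (fun r : ℝ => r ^ m) (𝓝[>] 0) (𝓝 0) := by
      have := (continuous_pow (M := ℝ) m).tendsto 0
      simpa [hm] using this.mono_left nhdsWithin_le_nhds
    -- Moving the base point of the metric from `ζ y` to `f (ζ y)` costs only `O(r ^ (m + 1))`,
    -- since `G` is Lipschitz near the origin and `g` has order `m + 1`.
    have t4 : Tendsto (fun r : ℝ => (r ^ m)⁻¹ • (G (f (((r : ℂ) * c) • y)) v w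
        - G (((r : ℂ) * c) • y) v w)) (𝓝[>] 0) (𝓝 0) := by
      have hb : Tendsto (fun r : ℝ => (K * C * ‖v‖ * ‖w‖) * r) (𝓝[>] 0) (𝓝 0) := by
        have := (continuous_const_mul (K * C * ‖v‖ * ‖w‖ : ℝ)).tendsto 0
        simpa using this.mono_left nhdsWithin_le_nhds
      refine squeeze_zero_norm' ?_ hb
      filter_upwards [hr.eventually hC, (hfline.comp hr).eventually hs,
        (hline.comp hr).eventually hs, self_mem_nhdsWithin] with r h1 h2 h3 h4
      have h4 : 0 < r := h4
      have hn : ‖(r : ℂ) * c‖ = r := by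
        rw [norm_mul, hc, mul_one, Complex.norm_real, Real.norm_of_nonneg h4.le]
      rw [hn] at h1
      have h5 := hK.norm_sub_le h2 h3
      rw [norm_smul, norm_inv, Real.norm_of_nonneg (by positivity : 0 ≤ r ^ m),
        inv_mul_le_iff₀ (by positivity)]
      calc ‖G (f (((r : ℂ) * c) • y)) v w - G (((r : ℂ) * c) • y) v w‖
          = ‖(G (f (((r : ℂ) * c) • y)) - G (((r : ℂ) * c) • y)) v w‖ := by simp
        _ ≤ ‖G (f (((r : ℂ) * c) • y)) - G (((r : ℂ) * c) • y)‖ * ‖v‖ * ‖w‖ :=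
          ContinuousLinearMap.le_opNorm₂ _ _ _
        _ ≤ (K * (C * r ^ (m + 1))) * ‖v‖ * ‖w‖ := by
          gcongr
          exact h5.trans (mul_le_mul_of_nonneg_left h1 K.2)
        _ = r ^ m * (K * C * ‖v‖ * ‖w‖ * r) := by ring
    have tsum := ((t4.add t1).add t2).add (tr.mul t3)
    rw [zero_mul, zero_add, add_zero] at tsum
    -- The sum whose limit was computed is the invariance identity divided by `r ^ m`, so it is zero
    -- for small `r`.
    refine tendsto_nhds_unique tsum (tendsto_const_nhds.congr' ?_)
    filter_upwards [(hline.comp hr).eventually hf, hr.eventually hDF, self_mem_nhdsWithin]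
      with r h1 h2 h4
    have h4 : 0 < r := h4
    have hDv : ∀ v, fderiv ℂ f (((r : ℂ) * c) • y) v
        = v + (r ^ m) • (c ^ m • F ((r : ℂ) * c) v) := by
      intro v
      have h := congrArg (fun T : E →L[ℂ] E => T v) h2
      simp only [hD, mul_pow, sub_apply, ContinuousLinearMap.id_apply,
        smul_apply, sub_eq_iff_eq_add] at h
      rw [h, mul_smul, add_comm, ← Complex.ofReal_pow, Complex.coe_smul]
    have h3 := h1.2.2 v w
    simp only [Function.comp_apply] at h3
    rw [hDv, hDv] at h3
    simp only [map_add, map_smul, add_apply, smul_apply,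
      smul_eq_mul] at h3 ⊢
    have hp : r ^ m ≠ 0 := by positivity
    field_simp
    linear_combination -h3
  -- This `c` makes `i F 0` skew, and `c = 1` makes `F 0` skew. As `G 0` is invariant under `i`, the
  -- two identities have opposite signs and leave `G 0 (F 0 v) w = 0`.
  obtain ⟨c, hc⟩ : ∃ c : ℂ, c ^ m = Complex.I := IsAlgClosed.exists_pow_nat_eq _ (by omega)
  have hc1 : ‖c‖ = 1 := by
    have := congrArg norm hc
    rw [norm_pow, Complex.norm_I] at this
    exact (pow_eq_one_iff_of_nonneg (norm_nonneg _) hm).1 this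
  refine hF0 (ContinuousLinearMap.ext fun v => hG0 _ fun w => ?_)
  have k1 := key 1 (by simp) v w
  have k2 := key c hc1 (Complex.I • v) w
  rw [hc, (F 0).map_smul, hGI, smul_smul, Complex.I_mul_I, neg_one_smul, map_neg, neg_apply] at k2
  simp only [one_pow, one_smul] at k1
  linarith

end Holomorphic

/-! ### The action of `U(1) × SU(2)` -/

/-- The real linear map `q ↦ λ q A` of `ℍ²`. -/
def linearAction (t : Circle) (A : Matrix.specialUnitaryGroup (Fin 2) ℂ) : Flat →L[ℝ] Flat :=
  LinearMap.toContinuousLinearMap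
    { toFun := fun q a => ((t : ℂ) : ℍ[ℝ]) *
        (q ᵥ* (A : Matrix (Fin 2) (Fin 2) ℂ).map Quaternion.coeComplex) a
      map_add' := fun p q => by
        funext a
        rw [Matrix.add_vecMul]
        exact mul_add _ _ _
      map_smul' := fun c q => by
        funext a
        rw [Matrix.smul_vecMul]
        exact mul_smul_comm c ((t : ℂ) : ℍ[ℝ]) _ }

lemma zc_linearAction (t : Circle) (A : Matrix.specialUnitaryGroup (Fin 2) ℂ) (b : Fin 2)
    (q : Flat) : zc b (linearAction t A q)
      = t * (zc 0 q * (A : Matrix (Fin 2) (Fin 2) ℂ) 0 b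
        + zc 1 q * (A : Matrix (Fin 2) (Fin 2) ℂ) 1 b) := by
  rw [← zc_vecMul]
  exact zc_mul_left b _ _

lemma wc_linearAction (t : Circle) (A : Matrix.specialUnitaryGroup (Fin 2) ℂ) (b : Fin 2)
    (q : Flat) : wc b (linearAction t A q)
      = t * (wc 0 q * conj ((A : Matrix (Fin 2) (Fin 2) ℂ) 0 b)
        + wc 1 q * conj ((A : Matrix (Fin 2) (Fin 2) ℂ) 1 b)) := by
  rw [← wc_vecMul]
  exact wc_mul_left b _ _

lemma specialUnitary_relations (A : Matrix.specialUnitaryGroup (Fin 2) ℂ) :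
    (A : Matrix (Fin 2) (Fin 2) ℂ) 0 0 * conj ((A : Matrix (Fin 2) (Fin 2) ℂ) 0 0)
      + (A : Matrix (Fin 2) (Fin 2) ℂ) 0 1 * conj ((A : Matrix (Fin 2) (Fin 2) ℂ) 0 1) = 1 ∧
    (A : Matrix (Fin 2) (Fin 2) ℂ) 0 0 * conj ((A : Matrix (Fin 2) (Fin 2) ℂ) 1 0)
      + (A : Matrix (Fin 2) (Fin 2) ℂ) 0 1 * conj ((A : Matrix (Fin 2) (Fin 2) ℂ) 1 1) = 0 ∧
    (A : Matrix (Fin 2) (Fin 2) ℂ) 1 0 * conj ((A : Matrix (Fin 2) (Fin 2) ℂ) 0 0)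
      + (A : Matrix (Fin 2) (Fin 2) ℂ) 1 1 * conj ((A : Matrix (Fin 2) (Fin 2) ℂ) 0 1) = 0 ∧
    (A : Matrix (Fin 2) (Fin 2) ℂ) 1 0 * conj ((A : Matrix (Fin 2) (Fin 2) ℂ) 1 0)
      + (A : Matrix (Fin 2) (Fin 2) ℂ) 1 1 * conj ((A : Matrix (Fin 2) (Fin 2) ℂ) 1 1) = 1 := by
  have hA := (Matrix.mem_unitaryGroup_iff.1 (Matrix.specialUnitaryGroup_le_unitaryGroup A.2))
  have e00 := congrFun (congrFun hA 0) 0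
  have e01 := congrFun (congrFun hA 0) 1
  have e10 := congrFun (congrFun hA 1) 0
  have e11 := congrFun (congrFun hA 1) 1
  simp [Matrix.mul_apply, Fin.sum_univ_two, Matrix.star_apply] at e00 e01 e10 e11
  exact ⟨e00, e01, e10, e11⟩

lemma flatInner_eq (ξ η : Flat) : flatInner ξ η =
    (zc 0 ξ * conj (zc 0 η) + zc 1 ξ * conj (zc 1 η)
      + (wc 0 ξ * conj (wc 0 η) + wc 1 ξ * conj (wc 1 η))).re := by
  simp [flatInner, Fin.sum_univ_two, Quaternion.inner_def, zc_apply, wc_apply]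
  ring

lemma flatInner_linearAction (t : Circle) (A : Matrix.specialUnitaryGroup (Fin 2) ℂ)
    (ξ η : Flat) : flatInner (linearAction t A ξ) (linearAction t A η) = flatInner ξ η := by
  obtain ⟨e00, e01, e10, e11⟩ := specialUnitary_relations A
  have ht := circle_mul_conj t
  rw [flatInner_eq, flatInner_eq]
  congr 1
  simp only [zc_linearAction, wc_linearAction, map_mul, map_add, Complex.conj_conj]
  generalize zc 0 ξ = x0
  generalize zc 1 ξ = x1
  generalize wc 0 ξ = y0
  generalize wc 1 ξ = y1
  generalize zc 0 η = z0
  generalize zc 1 η = z1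
  generalize wc 0 η = w0
  generalize wc 1 η = w1
  linear_combination ((t : ℂ) * conj (t : ℂ)) * ((x0 * conj z0 + y0 * conj w0) * e00
    + (x1 * conj z1 + y1 * conj w1) * e11
    + (x0 * conj z1 + y1 * conj w0) * e01 + (x1 * conj z0 + y0 * conj w1) * e10)
    + (x0 * conj z0 + x1 * conj z1 + y0 * conj w0 + y1 * conj w1) * ht

/-- `λ` is complex and so commutes with `i`, while `A` acts from the other side. This is what makes
the action holomorphic. -/
lemma linearAction_mul_left (t : Circle) (A : Matrix.specialUnitaryGroup (Fin 2) ℂ) (ξ : Flat) :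
    linearAction t A (fun a => qi * ξ a) = fun a => qi * linearAction t A ξ a := by
  apply flat_ext <;> intro a
  · rw [qi, zc_mul_left, zc_linearAction, zc_linearAction, zc_mul_left, zc_mul_left]
    ring
  · rw [qi, wc_mul_left, wc_linearAction, wc_linearAction, wc_mul_left, wc_mul_left]
    ring

/-- The action `q ↦ λ q A` on `μ⁻¹(i/2)`. -/
def levelAction (t : Circle) (A : Matrix.specialUnitaryGroup (Fin 2) ℂ) (q : LevelSet) :
    LevelSet := leftMul t (rightMul q A)

lemma coe_levelAction (t : Circle) (A : Matrix.specialUnitaryGroup (Fin 2) ℂ) (q : LevelSet) :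
    (levelAction t A q).1 = linearAction t A q.1 := rfl

/-- The entries of `A` are complex, so they commute with `e^{is}` on the right. -/
lemma levelAction_smul (t : Circle) (A : Matrix.specialUnitaryGroup (Fin 2) ℂ) (s : Circle)
    (q : LevelSet) : levelAction t A (s • q) = s • levelAction t A q := by
  apply Subtype.ext
  apply flat_ext <;> intro a
  · rw [zc_smul, coe_levelAction, coe_levelAction, zc_linearAction, zc_linearAction, zc_smul,
      zc_smul]
    ring
  · rw [wc_smul, coe_levelAction, coe_levelAction, wc_linearAction, wc_linearAction, wc_smul,
      wc_smul]
    ring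

/-- The two equations of `mem_horizontal_iff` are pairings of `ξ` with `p` that are invariant under
`A` because `A A* = 1`; under `λ` they are multiplied by `λ λ̄` and `λ²`. -/
lemma linearAction_mem_horizontal (t : Circle) (A : Matrix.specialUnitaryGroup (Fin 2) ℂ)
    (p : LevelSet) {ξ : Flat} (hξ : ξ ∈ horizontal p) :
    linearAction t A ξ ∈ horizontal (levelAction t A p) := by
  obtain ⟨e00, e01, e10, e11⟩ := specialUnitary_relations A
  have ht := circle_mul_conj t
  rw [mem_horizontal_iff] at hξ ⊢
  obtain ⟨h1, h2⟩ := hξ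
  simp only [coe_levelAction, zc_linearAction, wc_linearAction, map_mul, map_add,
    Complex.conj_conj]
  generalize zc 0 ξ = x0 at *
  generalize zc 1 ξ = x1 at *
  generalize wc 0 ξ = y0 at *
  generalize wc 1 ξ = y1 at *
  generalize zc 0 p.1 = z0 at *
  generalize zc 1 p.1 = z1 at *
  generalize wc 0 p.1 = w0 at *
  generalize wc 1 p.1 = w1 at *
  constructor
  · linear_combination ((t : ℂ) * conj (t : ℂ)) * (h1 + (x0 * conj z0 - y0 * conj w0) * e00
      + (x1 * conj z1 - y1 * conj w1) * e11
      + (x0 * conj z1 - y1 * conj w0) * e01 + (x1 * conj z0 - y0 * conj w1) * e10)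
  · linear_combination ((t : ℂ) * (t : ℂ)) * (h2 + (x0 * w0 + y0 * z0) * e00
      + (x1 * w1 + y1 * z1) * e11
      + (x0 * w1 + y1 * z0) * e01 + (x1 * w0 + y0 * z1) * e10)

/-- The map induced by `q ↦ λ q A` on the quotient. -/
def spaceAction (t : Circle) (A : Matrix.specialUnitaryGroup (Fin 2) ℂ) : Space → Space :=
  Quotient.map (sa := MulAction.orbitRel Circle LevelSet)
    (sb := MulAction.orbitRel Circle LevelSet) (levelAction t A) (by
    rintro p q ⟨s, rfl⟩
    exact ⟨s, (levelAction_smul t A s q).symm⟩)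

@[simp] lemma spaceAction_proj (t : Circle) (A : Matrix.specialUnitaryGroup (Fin 2) ℂ)
    (q : LevelSet) : spaceAction t A (proj q) = proj (levelAction t A q) := rfl

/-- The matrices compose in reverse order, being a right action; hence the opposite group in
`isometryAction`. -/
lemma levelAction_levelAction (s t : Circle) (A B : Matrix.specialUnitaryGroup (Fin 2) ℂ)
    (q : LevelSet) :
    levelAction s A (levelAction t B q) = levelAction (s * t) (B * A) q := by
  apply Subtype.ext
  apply flat_ext <;> intro a
  · simp only [coe_levelAction, zc_linearAction, Circle.coe_mul, Submonoid.coe_mul,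
      Matrix.mul_apply, Fin.sum_univ_two]
    ring
  · simp only [coe_levelAction, wc_linearAction, Circle.coe_mul, Submonoid.coe_mul,
      Matrix.mul_apply, Fin.sum_univ_two, map_add, map_mul]
    ring

lemma levelAction_one (q : LevelSet) : levelAction 1 1 q = q := by
  apply Subtype.ext
  apply flat_ext <;> intro a <;> fin_cases a <;>
    simp [coe_levelAction, zc_linearAction, wc_linearAction]

lemma spaceAction_spaceAction (s t : Circle) (A B : Matrix.specialUnitaryGroup (Fin 2) ℂ)
    (x : Space) : spaceAction s A (spaceAction t B x) = spaceAction (s * t) (B * A) x := by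
  obtain ⟨q, rfl⟩ := proj_surjective x
  simp only [spaceAction_proj, levelAction_levelAction]

lemma spaceAction_one (x : Space) : spaceAction 1 1 x = x := by
  obtain ⟨q, rfl⟩ := proj_surjective x
  simp only [spaceAction_proj, levelAction_one]

lemma continuous_spaceAction (t : Circle) (A : Matrix.specialUnitaryGroup (Fin 2) ℂ) :
    Continuous (spaceAction t A) := by
  have h : Continuous (levelAction t A) :=
    Continuous.subtype_mk ((linearAction t A).continuous.comp continuous_coe) _
  exact isQuotientMap_quotient_mk'.continuous_iff.2 (continuous_proj.comp h)

/-! ### Smoothness of the induced maps -/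

lemma contDiffAt_coord (a : Fin 2) {p : Flat} (h : zc a p ≠ 0) : ContDiffAt ℝ ω (coord a) p := by
  have hz : ∀ b, ContDiffAt ℝ ω (fun q : Flat => zc b q) p := fun b => (zc b).contDiff.contDiffAt
  have hw : ∀ b, ContDiffAt ℝ ω (fun q : Flat => wc b q) p := fun b => (wc b).contDiff.contDiffAt
  exact ((hz _).mul ((hz a).inv h)).prodMk ((hz _).mul (hw _))

lemma contDiffAt_coord_action (t : Circle) (A : Matrix.specialUnitaryGroup (Fin 2) ℂ)
    (a b : Fin 2) {y : ℂ × ℂ} (h : zc b (linearAction t A (sectionFlat a y)) ≠ 0) :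
    ContDiffAt ℝ ω (fun y => coord b (linearAction t A (sectionFlat a y))) y :=
  ContDiffAt.comp (g := coord b) y (contDiffAt_coord b h)
    ((linearAction t A).contDiff.comp (contDiff_sectionFlat a)).contDiffAt

lemma contMDiff_spaceAction (t : Circle) (A : Matrix.specialUnitaryGroup (Fin 2) ℂ) :
    ContMDiff 𝓘(ℝ, ℂ × ℂ) 𝓘(ℝ, ℂ × ℂ) ∞ (spaceAction t A) := by
  intro x
  rw [contMDiffAt_iff]
  refine ⟨(continuous_spaceAction t A).continuousAt, ?_⟩
  have hx : (chart (chartIndex x)).symm (chart (chartIndex x) x) = x :=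
    (chart (chartIndex x)).left_inv (mem_chartSource_chartIndex x)
  have h : zc (chartIndex (spaceAction t A x)) (linearAction t A
      (sectionFlat (chartIndex x) (chart (chartIndex x) x))) ≠ 0 := by
    refine zc_ne_zero_of_proj (p := levelAction t A (sectionMap _ _)) ?_
    rw [← spaceAction_proj]
    exact congrArg _ hx
  exact ((contDiffAt_coord_action t A _ _ h).of_le (by simp)).contDiffWithinAt

/-! ### Derivative of the action on the quotient -/

/-- Vectors that are tangent to `{z₀ w₀ + z₁ w₁ = 0}` and annihilated by the derivative of the
coordinates are tangent to the orbit of the complexified action. -/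
lemma exists_vertical (p : LevelSet) {a : Fin 2} (hz : zc a p.1 ≠ 0) {ξ : Flat}
    (h4 : zc 0 ξ * wc 0 p.1 + zc 1 ξ * wc 1 p.1 + wc 0 ξ * zc 0 p.1 + wc 1 ξ * zc 1 p.1 = 0)
    (h : fderiv ℝ (coord a) p.1 ξ = 0) :
    ∃ c, ∀ b, zc b ξ = c * zc b p.1 ∧ wc b ξ = -(c * wc b p.1) := by
  rw [(fderiv_coord a p.1 hz).2] at h
  obtain ⟨h6, h7⟩ := Prod.ext_iff.1 h
  simp only [Prod.fst_zero, Prod.snd_zero] at h6 h7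
  rw [div_eq_zero_iff, or_iff_left (pow_ne_zero 2 hz)] at h6
  refine ⟨zc a ξ / zc a p.1, ?_⟩
  obtain ⟨c, hc⟩ : ∃ c, c = zc a ξ / zc a p.1 := ⟨_, rfl⟩
  rw [← hc]
  have e0 : zc a ξ = c * zc a p.1 := by rw [hc]; field_simp
  have e1 : zc (1 - a) ξ = c * zc (1 - a) p.1 :=
    mul_right_cancel₀ hz (by linear_combination h6 + zc (1 - a) p.1 * e0)
  have e3 : wc (1 - a) ξ = -(c * wc (1 - a) p.1) :=
    mul_right_cancel₀ hz (by linear_combination h7 - wc (1 - a) p.1 * e0)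
  obtain rfl | rfl : a = 0 ∨ a = 1 := by fin_cases a <;> simp
  · simp only [show (1 - 0 : Fin 2) = 1 from rfl] at e1 e3
    have e2 : wc 0 ξ = -(c * wc 0 p.1) := mul_right_cancel₀ hz (by
      linear_combination h4 - wc 0 p.1 * e0 - wc 1 p.1 * e1 - zc 1 p.1 * e3)
    exact Fin.forall_fin_two.2 ⟨⟨e0, e2⟩, ⟨e1, e3⟩⟩
  · simp only [show (1 - 1 : Fin 2) = 0 from rfl] at e1 e3
    have e2 : wc 1 ξ = -(c * wc 1 p.1) := mul_right_cancel₀ hz (by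
      linear_combination h4 - wc 0 p.1 * e1 - wc 1 p.1 * e0 - zc 0 p.1 * e3)
    exact Fin.forall_fin_two.2 ⟨⟨e1, e3⟩, ⟨e0, e2⟩⟩

/-- The coordinates are invariant under the complexified action `z ↦ e^c z`, `w ↦ e^{-c} w`, whose
infinitesimal generator is `ξ`. -/
lemma fderiv_coord_vertical {p : Flat} {a : Fin 2} (hz : zc a p ≠ 0) {ξ : Flat} {c : ℂ}
    (h : ∀ b, zc b ξ = c * zc b p ∧ wc b ξ = -(c * wc b p)) : fderiv ℝ (coord a) p ξ = 0 := by
  rw [(fderiv_coord a p hz).2, (h a).1, (h (1 - a)).1, (h (1 - a)).2]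
  refine Prod.ext ?_ ?_
  · dsimp only
    rw [Prod.fst_zero, div_eq_zero_iff]
    left
    ring
  · dsimp only
    rw [Prod.snd_zero]
    ring

/-- Differentiates the complex moment map equation `z₀ w₀ + z₁ w₁ = 0` along the section. -/
lemma fderiv_section_tangent (a : Fin 2) (y v : ℂ × ℂ) :
    zc 0 (fderiv ℝ (sectionFlat a) y v) * wc 0 (sectionFlat a y)
      + zc 1 (fderiv ℝ (sectionFlat a) y v) * wc 1 (sectionFlat a y)
      + wc 0 (fderiv ℝ (sectionFlat a) y v) * zc 0 (sectionFlat a y)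
      + wc 1 (fderiv ℝ (sectionFlat a) y v) * zc 1 (sectionFlat a y) = 0 := by
  have hs : HasFDerivAt (sectionFlat a) (fderiv ℝ (sectionFlat a) y) y :=
    ((contDiff_sectionFlat a).differentiable (by simp) y).hasFDerivAt
  have hz : ∀ b, HasFDerivAt (fun y => zc b (sectionFlat a y)) _ y :=
    fun b => (zc b).hasFDerivAt.comp y hs
  have hw : ∀ b, HasFDerivAt (fun y => wc b (sectionFlat a y)) _ y :=
    fun b => (wc b).hasFDerivAt.comp y hs
  have h := ((hz 0).mul (hw 0)).add ((hz 1).mul (hw 1))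
  have h0 : HasFDerivAt (fun y => zc 0 (sectionFlat a y) * wc 0 (sectionFlat a y)
      + zc 1 (sectionFlat a y) * wc 1 (sectionFlat a y)) (0 : ℂ × ℂ →L[ℝ] ℂ) y := by
    refine (hasFDerivAt_const (0 : ℂ) y).congr_of_eventuallyEq (Eventually.of_forall fun z => ?_)
    exact ((momentMap_eq_iff _).1 (sectionFlat_mem a z)).2
  have e := congrArg (fun T : ℂ × ℂ →L[ℝ] ℂ => T v) (h.unique h0)
  simp at e
  linear_combination e

lemma fderiv_coord_section (a : Fin 2) (y v : ℂ × ℂ) :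
    fderiv ℝ (coord a) (sectionFlat a y) (fderiv ℝ (sectionFlat a) y v) = v := by
  have hz : zc a (sectionFlat a y) ≠ 0 := by
    rw [zc_section]
    exact sqrt_ne_zero' y
  have h := (fderiv_coord a _ hz).1.hasFDerivAt.comp y
    ((contDiff_sectionFlat a).differentiable (by simp) y).hasFDerivAt
  have h0 : HasFDerivAt (coord a ∘ sectionFlat a) (ContinuousLinearMap.id ℝ (ℂ × ℂ)) y :=
    (hasFDerivAt_id y).congr_of_eventuallyEq (Eventually.of_forall fun z => coord_section a z)
  exact congrArg (fun T : ℂ × ℂ →L[ℝ] ℂ × ℂ => T v) (h.unique h0)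

/-- The section point over `x` for the preferred chart at `x`. -/
def sectionPt (x : Space) : LevelSet := sectionMap (chartIndex x) (chart (chartIndex x) x)

lemma proj_sectionPt (x : Space) : proj (sectionPt x) = x :=
  (chart (chartIndex x)).left_inv (mem_chartSource_chartIndex x)

/-- In charts the map is `coord b ∘ linearAction t A ∘ sectionFlat a`, so its derivative involves
the lift of a tangent vector by the section, which need not be horizontal. The two lifts differ by a
vector along the complexified orbit; the linear action respects such vectors and `coord b` kills
them. -/
lemma mfderiv_spaceAction (t : Circle) (A : Matrix.specialUnitaryGroup (Fin 2) ℂ) (x : Space)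
    {ξ : Flat} (hξ : ξ ∈ horizontal (sectionPt x)) :
    mfderiv 𝓘(ℝ, ℂ × ℂ) 𝓘(ℝ, ℂ × ℂ) (spaceAction t A) x (projDeriv x (sectionPt x) ξ)
      = projDeriv (spaceAction t A x) (levelAction t A (sectionPt x)) (linearAction t A ξ) := by
  have hd := (contMDiff_spaceAction t A).mdifferentiable (by simp) x
  have h : zc (chartIndex (spaceAction t A x)) (linearAction t A
      (sectionFlat (chartIndex x) (chart (chartIndex x) x))) ≠ 0 := by
    refine zc_ne_zero_of_proj (p := levelAction t A (sectionPt x)) ?_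
    rw [← spaceAction_proj, proj_sectionPt]
  have hz : zc (chartIndex x) (sectionPt x).1 ≠ 0 := zc_ne_zero_of_proj (proj_sectionPt x)
  set a := chartIndex x with ha
  set b := chartIndex (spaceAction t A x) with hb
  set y := chart a x with hy
  have hs : HasFDerivAt (sectionFlat a) (fderiv ℝ (sectionFlat a) y) y :=
    ((contDiff_sectionFlat a).differentiable (by simp) y).hasFDerivAt
  have hder := (fderiv_coord b _ h).1.hasFDerivAt.comp y
    ((linearAction t A).hasFDerivAt.comp y hs)
  have hm : mfderiv 𝓘(ℝ, ℂ × ℂ) 𝓘(ℝ, ℂ × ℂ) (spaceAction t A) x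
      = fderiv ℝ (coord b ∘ linearAction t A ∘ sectionFlat a) y := by
    rw [hd.mfderiv]
    simp only [modelWithCornersSelf_coe, Set.range_id, fderivWithin_univ]
    rfl
  rw [hm]
  set v : ℂ × ℂ := projDeriv x (sectionPt x) ξ with hv
  refine (congrArg (fun T : ℂ × ℂ →L[ℝ] ℂ × ℂ => T v) hder.fderiv).trans ?_
  change fderiv ℝ (coord b) (linearAction t A (sectionFlat a y))
      (linearAction t A (fderiv ℝ (sectionFlat a) y v))
    = fderiv ℝ (coord b) (linearAction t A (sectionFlat a y)) (linearAction t A ξ)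
  obtain ⟨c, hc⟩ := exists_vertical (sectionPt x) hz
    (ξ := fderiv ℝ (sectionFlat a) y v - ξ) (by
      have e1 := fderiv_section_tangent a y v
      have e2 := ((mem_horizontal_iff _ _).1 hξ).2
      simp only [map_sub]
      change zc 0 ξ * wc 0 (sectionFlat a y) + zc 1 ξ * wc 1 (sectionFlat a y)
        + wc 0 ξ * zc 0 (sectionFlat a y) + wc 1 ξ * zc 1 (sectionFlat a y) = 0 at e2
      change (_ - _) * wc 0 (sectionFlat a y) + (_ - _) * wc 1 (sectionFlat a y)
        + (_ - _) * zc 0 (sectionFlat a y) + (_ - _) * zc 1 (sectionFlat a y) = 0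
      linear_combination e1 - e2) (by
      rw [map_sub, sub_eq_zero]
      exact fderiv_coord_section a y v)
  rw [← sub_eq_zero, ← map_sub, ← map_sub]
  refine fderiv_coord_vertical h (c := c) fun d => ?_
  rw [zc_linearAction, zc_linearAction, wc_linearAction, wc_linearAction, (hc 0).1, (hc 1).1,
    (hc 0).2, (hc 1).2]
  constructor
  · change (t : ℂ) * (c * zc 0 (sectionFlat a y) * _ + c * zc 1 (sectionFlat a y) * _) = _
    ring
  · change (t : ℂ) * (-(c * wc 0 (sectionFlat a y)) * _ + -(c * wc 1 (sectionFlat a y)) * _) = _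
    ring

/-! ### Invariance of the metric and of the complex structure -/

lemma exists_horizontal (x : Space) (v : TangentSpace 𝓘(ℝ, ℂ × ℂ) x) :
    ∃ ξ ∈ horizontal (sectionPt x), projDeriv x (sectionPt x) ξ = v := by
  obtain ⟨⟨ξ, hξ⟩, h⟩ := (projDeriv_bijective (proj_sectionPt x)).2 v
  exact ⟨ξ, hξ, h⟩

lemma metric_projDeriv' {x : Space} {p : LevelSet} (hp : proj p = x) {ξ η : Flat}
    (hξ : ξ ∈ horizontal p) (hη : η ∈ horizontal p) :
    metric x (projDeriv x p ξ) (projDeriv x p η) = flatInner ξ η := by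
  subst hp
  exact metric_projDeriv p hξ hη

lemma complexStructure_projDeriv' {x : Space} {p : LevelSet} (hp : proj p = x) {ξ : Flat}
    (hξ : ξ ∈ horizontal p) :
    complexStructure x (projDeriv x p ξ) = projDeriv x p (fun a => qi * ξ a) := by
  subst hp
  exact complexStructure_projDeriv p hξ

/-- The equations of `mem_horizontal_iff` are complex linear in `ξ`. -/
lemma qi_mul_mem_horizontal {p : LevelSet} {ξ : Flat} (hξ : ξ ∈ horizontal p) :
    (fun a => qi * ξ a) ∈ horizontal p := by
  rw [mem_horizontal_iff] at hξ ⊢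
  simp only [qi, zc_mul_left, wc_mul_left]
  constructor
  · linear_combination Complex.I * hξ.1
  · linear_combination Complex.I * hξ.2

lemma preservesMetric_spaceAction (t : Circle) (A : Matrix.specialUnitaryGroup (Fin 2) ℂ) :
    PreservesMetric (spaceAction t A) := by
  intro x v w
  obtain ⟨ξ, hξ, rfl⟩ := exists_horizontal x v
  obtain ⟨η, hη, rfl⟩ := exists_horizontal x w
  have hp : proj (levelAction t A (sectionPt x)) = spaceAction t A x := by
    rw [← spaceAction_proj, proj_sectionPt]
  rw [mfderiv_spaceAction t A x hξ, mfderiv_spaceAction t A x hη,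
    metric_projDeriv' hp (linearAction_mem_horizontal t A _ hξ)
      (linearAction_mem_horizontal t A _ hη), flatInner_linearAction,
    metric_projDeriv' (proj_sectionPt x) hξ hη]

lemma isHolomorphic_spaceAction (t : Circle) (A : Matrix.specialUnitaryGroup (Fin 2) ℂ) :
    IsHolomorphic (spaceAction t A) := by
  intro x v
  obtain ⟨ξ, hξ, rfl⟩ := exists_horizontal x v
  have hp : proj (levelAction t A (sectionPt x)) = spaceAction t A x := by
    rw [← spaceAction_proj, proj_sectionPt]
  rw [complexStructure_projDeriv' (proj_sectionPt x) hξ,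
    mfderiv_spaceAction t A x (qi_mul_mem_horizontal hξ), mfderiv_spaceAction t A x hξ,
    complexStructure_projDeriv' hp (linearAction_mem_horizontal t A _ hξ), linearAction_mul_left]

/-- The homeomorphism induced by `q ↦ λ q A`. -/
def homeoAction (t : Circle) (A : Matrix.specialUnitaryGroup (Fin 2) ℂ) : Space ≃ₜ Space where
  toFun := spaceAction t A
  invFun := spaceAction t⁻¹ A⁻¹
  left_inv x := by
    rw [spaceAction_spaceAction, inv_mul_cancel, mul_inv_cancel, spaceAction_one]
  right_inv x := by
    rw [spaceAction_spaceAction, mul_inv_cancel, inv_mul_cancel, spaceAction_one]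
  continuous_toFun := continuous_spaceAction t A
  continuous_invFun := continuous_spaceAction t⁻¹ A⁻¹

/-- The homomorphism from `U(1) × SU(2)`, the second factor acting from the right, to the group of
holomorphic isometries. -/
def isometryAction : Circle × (Matrix.specialUnitaryGroup (Fin 2) ℂ)ᵐᵒᵖ →*
    holomorphicIsometryGroup where
  toFun g := ⟨homeoAction g.1 g.2.unop, contMDiff_spaceAction _ _, contMDiff_spaceAction _ _,
    preservesMetric_spaceAction _ _, isHolomorphic_spaceAction _ _⟩
  map_one' := Subtype.ext (Homeomorph.ext spaceAction_one)
  map_mul' _ _ := Subtype.ext (Homeomorph.ext fun x => (spaceAction_spaceAction _ _ _ _ x).symm)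

/-! ### The kernel of the action -/

lemma det_specialUnitary (A : Matrix.specialUnitaryGroup (Fin 2) ℂ) :
    (A : Matrix (Fin 2) (Fin 2) ℂ) 0 0 * (A : Matrix (Fin 2) (Fin 2) ℂ) 1 1
      - (A : Matrix (Fin 2) (Fin 2) ℂ) 0 1 * (A : Matrix (Fin 2) (Fin 2) ℂ) 1 0 = 1 := by
  rw [← Matrix.det_fin_two]
  exact (Matrix.mem_specialUnitaryGroup_iff.1 A.2).2

lemma coord_linearAction_of_fixed {t : Circle} {A : Matrix.specialUnitaryGroup (Fin 2) ℂ}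
    {q : LevelSet} (h : spaceAction t A (proj q) = proj q) (a : Fin 2) :
    coord a (linearAction t A q.1) = coord a q.1 :=
  congrArg (chartFun a) h

/-- At the origin of chart `a` only `z_a` is nonzero, and its image has `z_{1-a}` proportional to
this entry of `A`. -/
lemma apply_eq_zero_of_fixed {t : Circle} {A : Matrix.specialUnitaryGroup (Fin 2) ℂ} {a : Fin 2}
    (h : spaceAction t A (proj (sectionMap a (0, 0))) = proj (sectionMap a (0, 0))) :
    (A : Matrix (Fin 2) (Fin 2) ℂ) a (1 - a) = 0 := by
  obtain ⟨s, hs⟩ := proj_eq_iff.1 h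
  have h1 := congrArg (fun q : LevelSet => zc (1 - a) q.1) hs
  simp only [zc_smul, coe_levelAction, zc_linearAction] at h1
  have hr := sqrt_ne_zero' ((0, 0) : ℂ × ℂ)
  have ht : (t : ℂ) ≠ 0 := t.coe_ne_zero
  change zc (1 - a) (sectionFlat a _) * _ = t * (zc 0 (sectionFlat a _) * _
    + zc 1 (sectionFlat a _) * _) at h1
  simp only [sectionFlat, zc_ofZW] at h1
  fin_cases a
  · simpa [ht, hr] using h1
  · simpa [ht, hr] using h1

lemma exists_circle_eq {z : ℂ} (hz : ‖z‖ = 1) : ∃ t : Circle, (t : ℂ) = z :=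
  ⟨⟨z, by
    change z ∈ Metric.sphere (0 : ℂ) 1
    simpa using hz⟩, rfl⟩

/-- A real sign can be moved to the right of `q`, where the circle action absorbs it: the element is
`t` if `A = 1` and `-t` if `A = -1`. -/
lemma spaceAction_eq_self_of_sign {t : Circle} (ht : (t : ℂ) = 1 ∨ (t : ℂ) = -1)
    {A : Matrix.specialUnitaryGroup (Fin 2) ℂ}
    (hA : (A : Matrix (Fin 2) (Fin 2) ℂ) = 1 ∨ (A : Matrix (Fin 2) (Fin 2) ℂ) = -1)
    (x : Space) : spaceAction t A x = x := by
  obtain ⟨q, rfl⟩ := proj_surjective x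
  rw [spaceAction_proj, proj_eq_iff]
  obtain ⟨s, hs⟩ : ∃ s : Circle, (s : ℂ) = -t := exists_circle_eq (by rw [norm_neg, Circle.norm_coe])
  have hc : conj (t : ℂ) = t := by rcases ht with h | h <;> simp [h]
  rcases hA with hA | hA
  · refine ⟨t, Subtype.ext (flat_ext (Fin.forall_fin_two.2 ?_) (Fin.forall_fin_two.2 ?_))⟩
    · simp [zc_smul, coe_levelAction, zc_linearAction, hA, mul_comm]
    · simp [wc_smul, coe_levelAction, wc_linearAction, hA, hc, mul_comm]
  · refine ⟨s, Subtype.ext (flat_ext (Fin.forall_fin_two.2 ?_) (Fin.forall_fin_two.2 ?_))⟩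
    · simp [zc_smul, coe_levelAction, zc_linearAction, hA, hs, mul_comm]
    · simp [wc_smul, coe_levelAction, wc_linearAction, hA, hs, hc, mul_comm]

lemma spaceAction_eq_self_iff (t : Circle) (A : Matrix.specialUnitaryGroup (Fin 2) ℂ) :
    (∀ x, spaceAction t A x = x) ↔ ((t : ℂ) = 1 ∨ (t : ℂ) = -1) ∧
      ((A : Matrix (Fin 2) (Fin 2) ℂ) = 1 ∨ (A : Matrix (Fin 2) (Fin 2) ℂ) = -1) := by
  refine ⟨fun h => ?_, fun h => spaceAction_eq_self_of_sign h.1 h.2⟩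
  have h01 : (A : Matrix (Fin 2) (Fin 2) ℂ) 0 1 = 0 := apply_eq_zero_of_fixed (a := 0) (h _)
  have h10 : (A : Matrix (Fin 2) (Fin 2) ℂ) 1 0 = 0 := apply_eq_zero_of_fixed (a := 1) (h _)
  have hdet := det_specialUnitary A
  rw [h01, zero_mul, sub_zero] at hdet
  have h00 : (A : Matrix (Fin 2) (Fin 2) ℂ) 0 0 ≠ 0 := left_ne_zero_of_mul (by rw [hdet]; simp)
  -- With `A` already diagonal, one test point with both coordinates nonzero suffices: `u = 1` gives
  -- equal diagonal entries, hence `A = ±1` by the determinant, and `v = 1` gives `t² = 1`.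
  have hc := coord_linearAction_of_fixed (h (proj (sectionMap 0 (1, 1)))) 0
  change coord 0 (linearAction t A (sectionFlat 0 (1, 1))) = coord 0 (sectionFlat 0 (1, 1)) at hc
  rw [coord_section] at hc
  have hr := sqrt_ne_zero' ((1, 1) : ℂ × ℂ)
  have ht : (t : ℂ) ≠ 0 := t.coe_ne_zero
  simp only [coord, zc_linearAction, wc_linearAction, h01, h10, Prod.mk.injEq, sectionFlat,
    zc_ofZW, wc_ofZW, sub_zero] at hc
  simp only [if_true, one_ne_zero, if_false, map_zero, mul_zero, add_zero, zero_add, one_mul] at hc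
  obtain ⟨hc1, hc2⟩ := hc
  rw [div_eq_one_iff_eq (by simp [ht, hr, h00])] at hc1
  have e : (A : Matrix (Fin 2) (Fin 2) ℂ) 1 1 = (A : Matrix (Fin 2) (Fin 2) ℂ) 0 0 :=
    mul_left_cancel₀ hr (mul_left_cancel₀ ht hc1)
  have hA : (A : Matrix (Fin 2) (Fin 2) ℂ) 0 0 = 1 ∨ (A : Matrix (Fin 2) (Fin 2) ℂ) 0 0 = -1 := by
    rw [e] at hdet
    exact mul_self_eq_one_iff.1 hdet
  constructor
  · refine mul_self_eq_one_iff.1 ?_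
    rw [e] at hc2
    field_simp at hc2
    rcases hA with hA | hA <;> rw [hA] at hc2 <;> simpa [sq] using hc2
  · refine hA.imp (fun hA => ?_) fun hA => ?_
    · ext i j
      fin_cases i <;> fin_cases j <;> simp [h01, h10, e, hA]
    · ext i j
      fin_cases i <;> fin_cases j <;> simp [h01, h10, e, hA]

lemma isometryAction_eq_one_iff (t : Circle) (A : Matrix.specialUnitaryGroup (Fin 2) ℂ) :
    isometryAction (t, MulOpposite.op A) = 1 ↔ ((t : ℂ) = 1 ∨ (t : ℂ) = -1) ∧
      ((A : Matrix (Fin 2) (Fin 2) ℂ) = 1 ∨ (A : Matrix (Fin 2) (Fin 2) ℂ) = -1) := by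
  rw [← spaceAction_eq_self_iff]
  constructor
  · intro h x
    exact congrArg (fun φ : holomorphicIsometryGroup => φ.1 x) h
  · intro h
    exact Subtype.ext (Homeomorph.ext h)

/-! ### The covering `U(1) × SU(2) → U(2) / {±1}` -/

/-- The homomorphism `(λ, A) ↦ [λ A]`. -/
def scaleHom : Circle × Matrix.specialUnitaryGroup (Fin 2) ℂ →*
    Matrix.unitaryGroup (Fin 2) ℂ ⧸ pmOne where
  toFun g := QuotientGroup.mk (scale g.1 g.2)
  map_one' := by
    rw [← QuotientGroup.mk_one]
    congr 1
    apply Subtype.ext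
    simp [scale]
  map_mul' g h := by
    rw [← QuotientGroup.mk_mul]
    congr 1
    apply Subtype.ext
    simp [scale, smul_smul, mul_comm]

lemma coe_scale (t : Circle) (A : Matrix.specialUnitaryGroup (Fin 2) ℂ) :
    (scale t A : Matrix (Fin 2) (Fin 2) ℂ) = (t : ℂ) • (A : Matrix (Fin 2) (Fin 2) ℂ) := rfl

lemma exists_circle_mul_self {z : ℂ} (hz : ‖z‖ = 1) : ∃ t : Circle, (t : ℂ) * t = z := by
  obtain ⟨s, hs⟩ := IsAlgClosed.exists_pow_nat_eq z (n := 2) (by norm_num)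
  obtain ⟨t, rfl⟩ := exists_circle_eq (z := s) (by
    have := congrArg norm hs
    rw [norm_pow, hz] at this
    exact (pow_eq_one_iff_of_nonneg (norm_nonneg _) (by norm_num)).1 this)
  exact ⟨t, by rw [← hs, sq]⟩

/-- Divide a unitary matrix by a square root of its determinant. -/
lemma scaleHom_surjective : Function.Surjective scaleHom := by
  intro g
  obtain ⟨U, rfl⟩ := QuotientGroup.mk_surjective g
  have hU := Matrix.mem_unitaryGroup_iff.1 U.2
  have hdet : ‖(U : Matrix (Fin 2) (Fin 2) ℂ).det‖ = 1 :=
    CStarRing.norm_of_mem_unitary (Matrix.det_of_mem_unitary U.2)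
  obtain ⟨t, ht⟩ := exists_circle_mul_self hdet
  have ht0 : (t : ℂ) ≠ 0 := t.coe_ne_zero
  have hA : ((t⁻¹ : Circle) : ℂ) • (U : Matrix (Fin 2) (Fin 2) ℂ) ∈
      Matrix.specialUnitaryGroup (Fin 2) ℂ := by
    rw [Matrix.mem_specialUnitaryGroup_iff, Matrix.mem_unitaryGroup_iff, star_smul,
      smul_mul_smul_comm, hU]
    constructor
    · change (((t⁻¹ : Circle) : ℂ) * conj ((t⁻¹ : Circle) : ℂ)) •
        (1 : Matrix (Fin 2) (Fin 2) ℂ) = 1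
      rw [circle_mul_conj, one_smul]
    · rw [Matrix.det_smul, ← ht, Circle.coe_inv]
      simp
      field_simp
  refine ⟨(t, ⟨_, hA⟩), ?_⟩
  change QuotientGroup.mk (scale t _) = _
  congr 1
  apply Subtype.ext
  rw [coe_scale]
  simp [smul_smul, ht0]

/-- Since `det A = 1` and `det (±1) = 1` in dimension two, `t A = ±1` forces `t² = 1`. -/
lemma scaleHom_eq_one_iff (t : Circle) (A : Matrix.specialUnitaryGroup (Fin 2) ℂ) :
    scaleHom (t, A) = 1 ↔ ((t : ℂ) = 1 ∨ (t : ℂ) = -1) ∧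
      ((A : Matrix (Fin 2) (Fin 2) ℂ) = 1 ∨ (A : Matrix (Fin 2) (Fin 2) ℂ) = -1) := by
  have h1 : scaleHom (t, A) = 1 ↔ (t : ℂ) • (A : Matrix (Fin 2) (Fin 2) ℂ) = 1 ∨
      (t : ℂ) • (A : Matrix (Fin 2) (Fin 2) ℂ) = -1 := by
    change ((scale t A : Matrix.unitaryGroup (Fin 2) ℂ) :
      Matrix.unitaryGroup (Fin 2) ℂ ⧸ pmOne) = 1 ↔ _
    rw [QuotientGroup.eq_one_iff]
    change scale t A = 1 ∨ scale t A = -1 ↔ _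
    rw [Subtype.ext_iff, Subtype.ext_iff]
    rfl
  rw [h1]
  constructor
  · intro h
    have hdet : ((t : ℂ) • (A : Matrix (Fin 2) (Fin 2) ℂ)).det = 1 := by
      rcases h with h | h <;> simp [h, Matrix.det_neg]
    rw [Matrix.det_smul, (Matrix.mem_specialUnitaryGroup_iff.1 A.2).2, mul_one,
      Fintype.card_fin, sq] at hdet
    have ht := mul_self_eq_one_iff.1 hdet
    refine ⟨ht, ?_⟩
    rcases ht with ht | ht <;> rw [ht] at h
    · simpa using h
    · rw [neg_one_smul, neg_inj, neg_eq_iff_eq_neg] at h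
      exact h.symm
  · rintro ⟨ht | ht, hA | hA⟩ <;> simp [ht, hA]

/-- The homomorphism `(λ, A) ↦ ([q] ↦ [λ q A⁻¹])`. -/
def leftIsometryAction : Circle × Matrix.specialUnitaryGroup (Fin 2) ℂ →*
    holomorphicIsometryGroup :=
  isometryAction.comp ((MonoidHom.id Circle).prodMap
    (MulEquiv.inv' (Matrix.specialUnitaryGroup (Fin 2) ℂ)).toMonoidHom)

lemma leftIsometryAction_apply (t : Circle) (A : Matrix.specialUnitaryGroup (Fin 2) ℂ) :
    leftIsometryAction (t, A) = isometryAction (t, MulOpposite.op A⁻¹) := rfl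

lemma inv_eq_sign_iff (A : Matrix.specialUnitaryGroup (Fin 2) ℂ) :
    ((A⁻¹ : Matrix.specialUnitaryGroup (Fin 2) ℂ) : Matrix (Fin 2) (Fin 2) ℂ) = 1 ∨
      ((A⁻¹ : Matrix.specialUnitaryGroup (Fin 2) ℂ) : Matrix (Fin 2) (Fin 2) ℂ) = -1 ↔
    (A : Matrix (Fin 2) (Fin 2) ℂ) = 1 ∨ (A : Matrix (Fin 2) (Fin 2) ℂ) = -1 := by
  have h : ((A⁻¹ : Matrix.specialUnitaryGroup (Fin 2) ℂ) : Matrix (Fin 2) (Fin 2) ℂ)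
      = star (A : Matrix (Fin 2) (Fin 2) ℂ) := rfl
  have h1 : ∀ B : Matrix (Fin 2) (Fin 2) ℂ, star (A : Matrix (Fin 2) (Fin 2) ℂ) = B ↔
      (A : Matrix (Fin 2) (Fin 2) ℂ) = star B := fun B => by rw [star_eq_iff_star_eq, eq_comm]
  rw [h, h1, h1, star_neg, star_one]

lemma ker_scaleHom : scaleHom.ker = leftIsometryAction.ker := by
  ext ⟨t, A⟩
  rw [MonoidHom.mem_ker, MonoidHom.mem_ker, scaleHom_eq_one_iff, leftIsometryAction_apply,
    isometryAction_eq_one_iff, inv_eq_sign_iff]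

/-- If `U(1) × SU(2)` exhausts the holomorphic isometries, then their group is `U(2) / {±1}`. -/
def unitaryQuotientEquiv (h : Function.Surjective leftIsometryAction) :
    (Matrix.unitaryGroup (Fin 2) ℂ ⧸ pmOne) ≃* holomorphicIsometryGroup :=
  ((QuotientGroup.quotientKerEquivOfSurjective scaleHom scaleHom_surjective).symm.trans
    (QuotientGroup.quotientMulEquivOfEq ker_scaleHom)).trans
    (QuotientGroup.quotientKerEquivOfSurjective leftIsometryAction h)

lemma unitaryQuotientEquiv_mk (h : Function.Surjective leftIsometryAction) (t : Circle)
    (A : Matrix.specialUnitaryGroup (Fin 2) ℂ) :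
    unitaryQuotientEquiv h (QuotientGroup.mk (scale t A)) = leftIsometryAction (t, A) := by
  have e : (QuotientGroup.quotientKerEquivOfSurjective scaleHom scaleHom_surjective).symm
      (QuotientGroup.mk (scale t A)) = QuotientGroup.mk (t, A) := by
    rw [MulEquiv.symm_apply_eq]
    rfl
  simp only [unitaryQuotientEquiv, MulEquiv.trans_apply]
  rw [e]
  rfl

/-! ### Holomorphic isometries in the charts -/

/-- The derivative of the projection is complex linear in `ξ`, so the charts are holomorphic
coordinates for the complex structure. -/
lemma complexStructure_eq (x : Space) (v : ℂ × ℂ) :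
    (complexStructure x v : ℂ × ℂ) = Complex.I • v := by
  obtain ⟨ξ, hξ, h⟩ := exists_horizontal x v
  rw [show v = projDeriv x (sectionPt x) ξ from h.symm]
  refine (complexStructure_projDeriv' (proj_sectionPt x) hξ).trans ?_
  rw [projDeriv_apply (proj_sectionPt x), projDeriv_apply (proj_sectionPt x)]
  simp only [qi, zc_mul_left, wc_mul_left]
  refine Prod.ext ?_ ?_
  · simp only [Prod.smul_fst, smul_eq_mul]
    ring
  · simp only [Prod.smul_snd, smul_eq_mul]
    ring

/-- The expression of a map in the preferred charts at `x` and its image. -/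
def chartExpr (φ : Space → Space) (x : Space) : ℂ × ℂ → ℂ × ℂ :=
  chart (chartIndex (φ x)) ∘ φ ∘ (chart (chartIndex x)).symm

lemma mfderiv_eq_fderiv_chartExpr {φ : Space → Space}
    (hφ : ContMDiff 𝓘(ℝ, ℂ × ℂ) 𝓘(ℝ, ℂ × ℂ) ∞ φ) (x : Space) :
    mfderiv 𝓘(ℝ, ℂ × ℂ) 𝓘(ℝ, ℂ × ℂ) φ x
      = fderiv ℝ (chartExpr φ x) (chart (chartIndex x) x) := by
  rw [(hφ.mdifferentiable (by simp) x).mfderiv]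
  simp only [modelWithCornersSelf_coe, Set.range_id, fderivWithin_univ]
  rfl

lemma contDiffAt_chartExpr {φ : Space → Space}
    (hφ : ContMDiff 𝓘(ℝ, ℂ × ℂ) 𝓘(ℝ, ℂ × ℂ) ∞ φ) (x : Space) :
    ContDiffAt ℝ ∞ (chartExpr φ x) (chart (chartIndex x) x) := by
  have h := (contMDiffAt_iff.1 (hφ x)).2
  simp only [modelWithCornersSelf_coe, Set.range_id, contDiffWithinAt_univ] at h
  exact h

lemma differentiableAt_chartExpr {φ : Space → Space}
    (hφ : ContMDiff 𝓘(ℝ, ℂ × ℂ) 𝓘(ℝ, ℂ × ℂ) ∞ φ) (hI : IsHolomorphic φ) (x : Space) :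
    DifferentiableAt ℂ (chartExpr φ x) (chart (chartIndex x) x) := by
  refine differentiableAt_complex ((contDiffAt_chartExpr hφ x).differentiableAt (by simp))
    fun v => ?_
  have h := hI x v
  rw [mfderiv_eq_fderiv_chartExpr hφ x] at h
  have e1 := complexStructure_eq x v
  have e2 := complexStructure_eq (φ x) (fderiv ℝ (chartExpr φ x) (chart (chartIndex x) x) v)
  exact (congrArg (fderiv ℝ (chartExpr φ x) (chart (chartIndex x) x)) e1).symm.trans (h.trans e2)

lemma chartIndex_eq_zero {x : Space} (hx : x ∈ chartSource 0) : chartIndex x = 0 := if_pos hx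

lemma chart_symm_mem (a : Fin 2) (y : ℂ × ℂ) : (chart a).symm y ∈ chartSource a :=
  (chart a).map_target (Set.mem_univ _)

lemma chart_chart_symm (a : Fin 2) (y : ℂ × ℂ) : chart a ((chart a).symm y) = y :=
  (chart a).right_inv (Set.mem_univ _)

lemma continuous_chart_symm (a : Fin 2) : Continuous (chart a).symm :=
  continuous_proj.comp (continuous_sectionMap a)

/-! ### The invariant functions `z_a w_b` -/

/-- The function `z_a w_b` on the quotient. -/
def invariant (a b : Fin 2) : Space → ℂ :=
  Quotient.lift (fun q : LevelSet => zc a q.1 * wc b q.1) (by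
    rintro p q ⟨t, rfl⟩
    have ht := circle_mul_conj t
    simp only [zc_smul, wc_smul]
    linear_combination zc a q.1 * wc b q.1 * ht)

@[simp] lemma invariant_proj (a b : Fin 2) (q : LevelSet) :
    invariant a b (proj q) = zc a q.1 * wc b q.1 := rfl

lemma continuous_invariant (a b : Fin 2) : Continuous (invariant a b) := by
  refine isQuotientMap_quotient_mk'.continuous_iff.2 ?_
  exact ((zc a).continuous.comp continuous_coe).mul ((wc b).continuous.comp continuous_coe)

/-- The square roots in the section cancel: in each chart `z_a w_b` is a polynomial, hence
holomorphic. -/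
lemma invariant_chart_symm (a b c : Fin 2) (y : ℂ × ℂ) : invariant a b ((chart c).symm y)
    = (if a = c then 1 else y.1) * (if b = c then -(y.1 * y.2) else y.2) := by
  change zc a (sectionFlat c y) * wc b (sectionFlat c y) = _
  have hr := sqrt_ne_zero' y
  simp only [sectionFlat, zc_ofZW, wc_ofZW]
  split_ifs <;> field_simp

lemma invariant_eq (a b c : Fin 2) {x : Space} (hx : x ∈ chartSource c) : invariant a b x
    = (if a = c then 1 else (chart c x).1)
      * (if b = c then -((chart c x).1 * (chart c x).2) else (chart c x).2) := by
  rw [← invariant_chart_symm]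
  congr 1
  exact ((chart c).left_inv hx).symm

lemma differentiable_invariant_chart (a b c : Fin 2) : Differentiable ℂ
    fun y : ℂ × ℂ => (if a = c then 1 else y.1) * (if b = c then -(y.1 * y.2) else y.2) := by
  split_ifs <;> fun_prop

/-- The functions `z_a w_b` are holomorphic, also after composition with a holomorphic map. -/
lemma differentiable_invariant_comp {φ : Space → Space}
    (hφ : ContMDiff 𝓘(ℝ, ℂ × ℂ) 𝓘(ℝ, ℂ × ℂ) ∞ φ) (hI : IsHolomorphic φ) (a b : Fin 2) :
    Differentiable ℂ fun y => invariant a b (φ ((chart 0).symm y)) := by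
  intro y
  set x := (chart 0).symm y with hx
  have h0 : chartIndex x = 0 := chartIndex_eq_zero (chart_symm_mem 0 y)
  have hd := differentiableAt_chartExpr hφ hI x
  rw [chartExpr, h0, hx, chart_chart_symm, ← hx] at hd
  have hc : ∀ᶠ y' in 𝓝 y, φ ((chart 0).symm y') ∈ chartSource (chartIndex (φ x)) :=
    (hφ.continuous.comp (continuous_chart_symm 0)).continuousAt.eventually
      ((isOpen_chartSource _).mem_nhds (mem_chartSource_chartIndex _))
  refine DifferentiableAt.congr_of_eventuallyEq ?_
    (hc.mono fun y' hy' => invariant_eq a b _ hy')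
  exact (differentiable_invariant_chart a b (chartIndex (φ x))).differentiableAt.comp y hd

/-- Some `z_c` is nonzero, so `w_{1-c} = 0`, and then `z₀ w₀ + z₁ w₁ = 0` gives `w_c = 0`. The
off-diagonal invariants therefore cut out the zero section. -/
lemma wc_eq_zero_of_invariant {q : LevelSet} (h : ∀ a, invariant a (1 - a) (proj q) = 0)
    (a : Fin 2) : wc a q.1 = 0 := by
  obtain ⟨-, h2⟩ := (momentMap_eq_iff q.1).1 q.2
  have h01 : zc 0 q.1 * wc 1 q.1 = 0 := h 0
  have h10 : zc 1 q.1 * wc 0 q.1 = 0 := h 1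
  have key : wc 0 q.1 = 0 ∧ wc 1 q.1 = 0 := by
    rcases exists_mem_chartSource (proj q) with hz | hz <;> rw [proj_mem_chartSource] at hz
    · have e1 : wc 1 q.1 = 0 := by simpa [hz] using h01
      rw [e1] at h2
      exact ⟨by simpa [hz] using h2, e1⟩
    · have e1 : wc 0 q.1 = 0 := by simpa [hz] using h10
      rw [e1] at h2
      exact ⟨e1, by simpa [hz] using h2⟩
  fin_cases a
  · exact key.1
  · exact key.2

/-- The functions `z_a w_b` separate the points outside of the zero section. -/
lemma eq_of_invariant_eq {x y : Space} (h : ∀ a b, invariant a b x = invariant a b y)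
    (hx : ∃ a, invariant a (1 - a) x ≠ 0) : x = y := by
  obtain ⟨c, hc⟩ := hx
  have hc' : invariant c (1 - c) y ≠ 0 := h c (1 - c) ▸ hc
  obtain ⟨p, rfl⟩ := proj_surjective x
  obtain ⟨q, rfl⟩ := proj_surjective y
  rw [invariant_proj] at hc hc'
  have hp := left_ne_zero_of_mul hc
  have hq := left_ne_zero_of_mul hc'
  have hp' := right_ne_zero_of_mul hc
  have hq' := right_ne_zero_of_mul hc'
  have h1 := h c (1 - c)
  have h2 := h (1 - c) (1 - c)
  simp only [invariant_proj] at h1 h2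
  rw [← proj_section c p hp, ← proj_section c q hq]
  congr 2
  refine Prod.ext ?_ h1
  simp only [coord]
  rw [div_eq_div_iff hp hq]
  -- The ratio `z_{1-c} / z_c` is recovered as the quotient of two invariants with common factor
  -- `w_{1-c}`.
  refine mul_right_cancel₀ (mul_ne_zero hp' hq') ?_
  linear_combination zc c q.1 * wc (1 - c) q.1 * h2 - zc (1 - c) q.1 * wc (1 - c) q.1 * h1

/-! ### The zero section is preserved -/

/-- Where `w = 0` the moment map equation reads `|z₀|² + |z₁|² = 1`. -/
lemma isCompact_zeroSection : IsCompact {q : LevelSet | ∀ a, wc a q.1 = 0} := by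
  have hcont : Continuous momentMap := by
    unfold momentMap
    fun_prop
  have hemb : Topology.IsClosedEmbedding (fun q : LevelSet => q.1) :=
    (isClosed_eq hcont continuous_const).isClosedEmbedding_subtypeVal
  refine (hemb.isCompact_preimage (isCompact_closedBall (0 : Flat) 1)).of_isClosed_subset ?_ ?_
  · simp only [Set.ofPred_forall]
    exact isClosed_iInter fun a =>
      isClosed_eq ((wc a).continuous.comp continuous_coe) continuous_const
  · intro q hq
    obtain ⟨h1, -⟩ := (momentMap_eq_iff q.1).1 q.2
    rw [hq 0, hq 1] at h1
    have h1 := congrArg Complex.re h1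
    simp only [Set.mem_preimage, mem_closedBall_zero_iff]
    rw [pi_norm_le_iff_of_nonneg zero_le_one]
    intro a
    have hw := hq a
    rw [wc_apply] at hw
    have hJ : (q.1 a).imJ = 0 := congrArg Complex.re hw
    have hK : (q.1 a).imK = 0 := congrArg Complex.im hw
    have hn : ‖q.1 a‖ ^ 2 ≤ 1 := by
      rw [sq, ← Quaternion.normSq_eq_norm_mul_self, Quaternion.normSq_def', hJ, hK]
      simp [zc_apply] at h1
      fin_cases a <;> simp <;> nlinarith
    nlinarith [norm_nonneg (q.1 a)]

lemma chart_symm_mem_zeroSection (a : Fin 2) (u : ℂ) (b : Fin 2) :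
    wc b (sectionMap a (u, 0)).1 = 0 := by
  change wc b (sectionFlat a (u, 0)) = 0
  simp [sectionFlat]

/-- A holomorphic diffeomorphism maps the zero section to itself. -/
lemma invariant_eq_zero {φ : Space → Space} (hφ : ContMDiff 𝓘(ℝ, ℂ × ℂ) 𝓘(ℝ, ℂ × ℂ) ∞ φ)
    (hI : IsHolomorphic φ) (hinj : Function.Injective φ) (u : ℂ) (a : Fin 2) :
    invariant a (1 - a) (φ ((chart 0).symm (u, 0))) = 0 := by
  have hconst : ∀ a b u u', invariant a b (φ ((chart 0).symm (u, 0)))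
      = invariant a b (φ ((chart 0).symm (u', 0))) := by
    intro a b u u'
    have hd : Differentiable ℂ fun u : ℂ => invariant a b (φ ((chart 0).symm (u, 0))) :=
      (differentiable_invariant_comp hφ hI a b).comp
        (differentiable_id.prodMk (differentiable_const 0))
    -- Liouville: the values lie in the image of the compact zero section.
    refine hd.apply_eq_apply_of_bounded ?_ u u'
    have hK := isCompact_zeroSection.image
      ((continuous_invariant a b).comp (hφ.continuous.comp continuous_proj))
    refine hK.isBounded.subset ?_
    rintro _ ⟨u, rfl⟩
    exact ⟨sectionMap 0 (u, 0), chart_symm_mem_zeroSection 0 u, rfl⟩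
  by_contra hne
  -- Off the zero section the constant invariants determine the point, so `φ` would identify the
  -- points with coordinates `(u, 0)` and `(u + 1, 0)`.
  have h := hinj (eq_of_invariant_eq (fun a b => hconst a b u (u + 1)) ⟨a, hne⟩)
  have h' := congrArg (chart 0) h
  rw [chart_chart_symm, chart_chart_symm] at h'
  simpa using congrArg Prod.fst h'

/-! ### The metric in a chart -/

/-- The squared length of the point of `μ⁻¹(i/2)` with coordinates `y`. -/
def sqLength (y : ℂ × ℂ) : ℂ :=
  zc 0 (sectionFlat 0 y) * conj (zc 0 (sectionFlat 0 y))
    + zc 1 (sectionFlat 0 y) * conj (zc 1 (sectionFlat 0 y))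
    + wc 0 (sectionFlat 0 y) * conj (wc 0 (sectionFlat 0 y))
    + wc 1 (sectionFlat 0 y) * conj (wc 1 (sectionFlat 0 y))

lemma sqLength_ne_zero (y : ℂ × ℂ) : sqLength y ≠ 0 := by
  obtain ⟨h1, -⟩ := (momentMap_eq_iff _).1 (sectionFlat_mem 0 y)
  unfold sqLength
  simp only [Complex.mul_conj] at h1 ⊢
  norm_cast at h1 ⊢
  have := Complex.normSq_nonneg (wc 0 (sectionFlat 0 y))
  have := Complex.normSq_nonneg (wc 1 (sectionFlat 0 y))
  linarith

/-- The `w₀`-component of a lift of the tangent vector `v` at the point with coordinates `y`. -/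
def liftW (y v : ℂ × ℂ) : ℂ :=
  -((zc 0 (sectionFlat 0 y) * v.1 * wc 1 (sectionFlat 0 y)
    + v.2 / zc 0 (sectionFlat 0 y) * zc 1 (sectionFlat 0 y)) / zc 0 (sectionFlat 0 y))

/-- The vertical correction that makes the lift horizontal. -/
def liftCoeff (y v : ℂ × ℂ) : ℂ :=
  -((zc 0 (sectionFlat 0 y) * v.1 * conj (zc 1 (sectionFlat 0 y))
      - liftW y v * conj (wc 0 (sectionFlat 0 y))
      - v.2 / zc 0 (sectionFlat 0 y) * conj (wc 1 (sectionFlat 0 y))) / sqLength y)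

/-- The horizontal lift of the tangent vector `v` to the point with coordinates `y`. -/
def chartLift (y v : ℂ × ℂ) : Flat :=
  ofZW ![liftCoeff y v * zc 0 (sectionFlat 0 y),
      zc 0 (sectionFlat 0 y) * v.1 + liftCoeff y v * zc 1 (sectionFlat 0 y)]
    ![liftW y v - liftCoeff y v * wc 0 (sectionFlat 0 y),
      v.2 / zc 0 (sectionFlat 0 y) - liftCoeff y v * wc 1 (sectionFlat 0 y)]

lemma zc_section_ne_zero (y : ℂ × ℂ) : zc 0 (sectionFlat 0 y) ≠ 0 := by
  rw [zc_section]
  exact sqrt_ne_zero' y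

lemma chartLift_mem_horizontal (y v : ℂ × ℂ) : chartLift y v ∈ horizontal (sectionMap 0 y) := by
  have hz := zc_section_ne_zero y
  have hr' : liftW y v * zc 0 (sectionFlat 0 y) = -(zc 0 (sectionFlat 0 y) * v.1
      * wc 1 (sectionFlat 0 y) + v.2 / zc 0 (sectionFlat 0 y) * zc 1 (sectionFlat 0 y)) := by
    rw [liftW]
    field_simp
  have hc' : liftCoeff y v * sqLength y
      = -(zc 0 (sectionFlat 0 y) * v.1 * conj (zc 1 (sectionFlat 0 y))
      - liftW y v * conj (wc 0 (sectionFlat 0 y))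
      - v.2 / zc 0 (sectionFlat 0 y) * conj (wc 1 (sectionFlat 0 y))) := by
    have := sqLength_ne_zero y
    rw [liftCoeff]
    field_simp
  rw [mem_horizontal_iff]
  change _ * conj (zc 0 (sectionFlat 0 y)) + _ * conj (zc 1 (sectionFlat 0 y))
      - _ * conj (wc 0 (sectionFlat 0 y)) - _ * conj (wc 1 (sectionFlat 0 y)) = 0 ∧
    _ * wc 0 (sectionFlat 0 y) + _ * wc 1 (sectionFlat 0 y) + _ * zc 0 (sectionFlat 0 y)
      + _ * zc 1 (sectionFlat 0 y) = 0
  simp only [chartLift, zc_ofZW, wc_ofZW, Matrix.cons_val_zero, Matrix.cons_val_one]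
  rw [sqLength] at hc'
  constructor
  · linear_combination hc'
  · linear_combination hr'

lemma fderiv_coord_chartLift (y v : ℂ × ℂ) :
    fderiv ℝ (coord 0) (sectionFlat 0 y) (chartLift y v) = v := by
  have hz := zc_section_ne_zero y
  rw [(fderiv_coord 0 _ hz).2]
  refine Prod.ext ?_ ?_
  · simp [chartLift]
    field_simp
    ring
  · simp [chartLift]
    field_simp
    ring

lemma contDiff_chartLift (v : ℂ × ℂ) : ContDiff ℝ ω fun y => chartLift y v := by
  have hz : ∀ b, ContDiff ℝ ω fun y => zc b (sectionFlat 0 y) :=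
    fun b => (zc b).contDiff.comp (contDiff_sectionFlat 0)
  have hw : ∀ b, ContDiff ℝ ω fun y => wc b (sectionFlat 0 y) :=
    fun b => (wc b).contDiff.comp (contDiff_sectionFlat 0)
  have hcz : ∀ b, ContDiff ℝ ω fun y => conj (zc b (sectionFlat 0 y)) :=
    fun b => Complex.conjCLE.contDiff.comp (hz b)
  have hcw : ∀ b, ContDiff ℝ ω fun y => conj (wc b (sectionFlat 0 y)) :=
    fun b => Complex.conjCLE.contDiff.comp (hw b)
  have hzi := (hz 0).inv zc_section_ne_zero
  have hN : ContDiff ℝ ω sqLength :=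
    ((((hz 0).mul (hcz 0)).add ((hz 1).mul (hcz 1))).add ((hw 0).mul (hcw 0))).add
      ((hw 1).mul (hcw 1))
  have hv2 : ContDiff ℝ ω fun y => v.2 / zc 0 (sectionFlat 0 y) := contDiff_const.mul hzi
  have hv1 : ContDiff ℝ ω fun y => zc 0 (sectionFlat 0 y) * v.1 := (hz 0).mul contDiff_const
  have hW : ContDiff ℝ ω fun y => liftW y v :=
    (((hv1.mul (hw 1)).add (hv2.mul (hz 1))).mul hzi).neg
  have hC : ContDiff ℝ ω fun y => liftCoeff y v :=
    ((((hv1.mul (hcz 1)).sub (hW.mul (hcw 0))).sub (hv2.mul (hcw 1))).mul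
      (hN.inv sqLength_ne_zero)).neg
  refine contDiff_ofZW.comp (ContDiff.prodMk (contDiff_pi.2 (Fin.forall_fin_two.2 ⟨?_, ?_⟩))
    (contDiff_pi.2 (Fin.forall_fin_two.2 ⟨?_, ?_⟩)))
  · exact hC.mul (hz 0)
  · exact hv1.add (hC.mul (hz 1))
  · exact hW.sub (hC.mul (hw 0))
  · exact hv2.sub (hC.mul (hw 1))

/-- The horizontal lift as a linear map. -/
def chartLiftL (y : ℂ × ℂ) : ℂ × ℂ →L[ℝ] Flat :=
  LinearMap.toContinuousLinearMap
    { toFun := chartLift y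
      map_add' := fun v w => by
        have hW : liftW y (v + w) = liftW y v + liftW y w := by
          simp only [liftW, Prod.fst_add, Prod.snd_add]
          ring
        have hC : liftCoeff y (v + w) = liftCoeff y v + liftCoeff y w := by
          simp only [liftCoeff, hW, Prod.fst_add, Prod.snd_add]
          ring
        refine flat_ext (Fin.forall_fin_two.2 ?_) (Fin.forall_fin_two.2 ?_)
        · simp only [chartLift, map_add, zc_ofZW, Matrix.cons_val_zero, Matrix.cons_val_one, hC,
            Prod.fst_add]
          constructor <;> ring
        · simp only [chartLift, map_add, wc_ofZW, Matrix.cons_val_zero, Matrix.cons_val_one, hC,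
            hW, Prod.snd_add]
          constructor <;> ring
      map_smul' := fun c v => by
        have hW : liftW y (c • v) = c * liftW y v := by
          simp only [liftW, Prod.smul_fst, Prod.smul_snd, Complex.real_smul]
          ring
        have hC : liftCoeff y (c • v) = c * liftCoeff y v := by
          simp only [liftCoeff, hW, Prod.smul_fst, Prod.smul_snd, Complex.real_smul]
          ring
        refine flat_ext (Fin.forall_fin_two.2 ?_) (Fin.forall_fin_two.2 ?_)
        · simp only [chartLift, map_smul, zc_ofZW, Matrix.cons_val_zero, Matrix.cons_val_one, hC,
            Prod.smul_fst, Complex.real_smul, RingHom.id_apply]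
          constructor <;> ring
        · simp only [chartLift, map_smul, wc_ofZW, Matrix.cons_val_zero, Matrix.cons_val_one, hC,
            hW, Prod.smul_snd, Complex.real_smul, RingHom.id_apply]
          constructor <;> ring }

/-- The flat metric as a continuous bilinear map. -/
def flatInnerL : Flat →L[ℝ] Flat →L[ℝ] ℝ :=
  ∑ a, (innerSL ℝ (E := ℍ[ℝ])).bilinearComp (ContinuousLinearMap.proj a)
    (ContinuousLinearMap.proj a)

lemma flatInnerL_apply (ξ η : Flat) : flatInnerL ξ η = flatInner ξ η := by
  simp [flatInnerL, flatInner]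

/-- The metric in the chart `z₀ ≠ 0`. -/
def chartMetric (y : ℂ × ℂ) : ℂ × ℂ →L[ℝ] ℂ × ℂ →L[ℝ] ℝ :=
  flatInnerL.bilinearComp (chartLiftL y) (chartLiftL y)

lemma chartMetric_apply (y v w : ℂ × ℂ) :
    chartMetric y v w = flatInner (chartLift y v) (chartLift y w) :=
  flatInnerL_apply _ _

/-- `metric` is defined through arbitrarily chosen points of the fibres, from which no regularity
can be read off. The explicit horizontal lift along the smooth section supplies it; rigidity needs
only order one. -/
lemma contDiff_chartMetric : ContDiff ℝ ω chartMetric := by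
  rw [contDiff_clm_apply_iff]
  intro v
  rw [contDiff_clm_apply_iff]
  intro w
  exact (flatInnerL.contDiff.comp (contDiff_chartLift v)).clm_apply (contDiff_chartLift w)

lemma metric_eq_chartMetric {x : Space} (hx : x ∈ chartSource 0) (v w : ℂ × ℂ) :
    metric x v w = chartMetric (chart 0 x) v w := by
  have hp : proj (sectionMap 0 (chart 0 x)) = x := (chart 0).left_inv hx
  have h : ∀ v, projDeriv x (sectionMap 0 (chart 0 x)) (chartLift (chart 0 x) v) = v := by
    intro v
    rw [projDeriv, chartIndex_eq_zero hx]
    exact fderiv_coord_chartLift (chart 0 x) v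
  rw [chartMetric_apply, ← metric_projDeriv' hp (chartLift_mem_horizontal _ v)
    (chartLift_mem_horizontal _ w), h, h]

lemma sqModulus_zero : sqModulus 0 = 1 := by
  simp [sqModulus]

lemma zc_sectionFlat_zero (b : Fin 2) : zc b (sectionFlat 0 0) = if b = 0 then 1 else 0 := by
  simp [sectionFlat, sqModulus_zero]

lemma wc_sectionFlat_zero (b : Fin 2) : wc b (sectionFlat 0 0) = 0 := by
  simp [sectionFlat]

lemma chartMetric_zero (v w : ℂ × ℂ) :
    chartMetric 0 v w = (v.1 * conj w.1 + v.2 * conj w.2).re := by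
  rw [chartMetric_apply, flatInner_eq]
  have hW : ∀ v, liftW 0 v = 0 := fun v => by
    simp [liftW, zc_sectionFlat_zero, wc_sectionFlat_zero]
  have hC : ∀ v, liftCoeff 0 v = 0 := fun v => by
    simp [liftCoeff, hW, zc_sectionFlat_zero, wc_sectionFlat_zero]
  simp [chartLift, hW, hC, zc_sectionFlat_zero, wc_sectionFlat_zero]

/-! ### Rigidity -/

/-- The invariants `z_a z̄_b` and `z_a w_b` separate points. The Hausdorff property is needed to
extend an equality of continuous maps from a dense set. -/
instance : T2Space Space := by
  have hH : ∀ a b, ∀ t : Circle, ∀ q : LevelSet,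
      zc a (t • q).1 * conj (zc b (t • q).1) = zc a q.1 * conj (zc b q.1) := by
    intro a b t q
    have ht := circle_mul_conj t
    simp only [zc_smul, map_mul]
    linear_combination zc a q.1 * conj (zc b q.1) * ht
  let H : Fin 2 → Fin 2 → Space → ℂ := fun a b =>
    Quotient.lift (fun q : LevelSet => zc a q.1 * conj (zc b q.1)) (by
      rintro p q ⟨t, rfl⟩
      exact hH a b t q)
  have hHc : ∀ a b, Continuous (H a b) := fun a b =>
    isQuotientMap_quotient_mk'.continuous_iff.2
      (((zc a).continuous.comp continuous_coe).mul
        (Complex.continuous_conj.comp ((zc b).continuous.comp continuous_coe)))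
  refine T2Space.of_injective_continuous
    (f := fun x : Space => ((fun a b => H a b x : Fin 2 → Fin 2 → ℂ),
      (fun a b => invariant a b x : Fin 2 → Fin 2 → ℂ))) ?_ ?_
  · intro x y hxy
    obtain ⟨h1, h2⟩ := Prod.ext_iff.1 hxy
    obtain ⟨p, rfl⟩ := proj_surjective x
    obtain ⟨q, rfl⟩ := proj_surjective y
    have h1 : ∀ a b, zc a p.1 * conj (zc b p.1) = zc a q.1 * conj (zc b q.1) :=
      fun a b => congrFun (congrFun h1 a) b
    have h2 : ∀ a b, zc a p.1 * wc b p.1 = zc a q.1 * wc b q.1 :=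
      fun a b => congrFun (congrFun h2 a) b
    obtain ⟨c, hc⟩ : ∃ c, proj p ∈ chartSource c := by
      rcases exists_mem_chartSource (proj p) with h | h
      exacts [⟨0, h⟩, ⟨1, h⟩]
    have hp : zc c p.1 ≠ 0 := proj_mem_chartSource.1 hc
    have hpc : conj (zc c p.1) ≠ 0 := (map_ne_zero _).2 hp
    have hq : zc c q.1 ≠ 0 := left_ne_zero_of_mul (h1 c c ▸ mul_ne_zero hp hpc)
    have hqc : conj (zc c q.1) ≠ 0 := (map_ne_zero _).2 hq
    rw [← proj_section c p hp, ← proj_section c q hq]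
    congr 2
    refine Prod.ext ?_ (h2 c (1 - c))
    simp only [coord]
    rw [div_eq_div_iff hp hq]
    refine mul_right_cancel₀ (mul_ne_zero hpc hqc) ?_
    linear_combination (zc c q.1 * conj (zc c q.1)) * h1 (1 - c) c
      - zc (1 - c) q.1 * conj (zc c q.1) * h1 c c
  · exact (continuous_pi fun a => continuous_pi fun b => hHc a b).prodMk
      (continuous_pi fun a => continuous_pi fun b => continuous_invariant a b)

lemma dense_chart : Dense (chartSource 0 ∩ {x | invariant 0 1 x ≠ 0}) := by
  have hd : ∀ z : ℂ, ∃ u : ℕ → ℂ, Tendsto u atTop (𝓝 z) ∧ ∀ n, u n ≠ 0 := fun z => by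
    have : z ∈ closure {0}ᶜ := (dense_compl_singleton (0 : ℂ)).closure_eq ▸ Set.mem_univ z
    obtain ⟨u, hu, h⟩ := mem_closure_iff_seq_limit.1 this
    exact ⟨u, h, hu⟩
  intro x
  set c := chartIndex x with hc
  have hx : (chart c).symm (chart c x) = x :=
    (chart c).left_inv (mem_chartSource_chartIndex x)
  obtain ⟨u, hu, hu0⟩ := hd (chart c x).1
  obtain ⟨v, hv, hv0⟩ := hd (chart c x).2
  have hlim : Tendsto (fun n => (chart c).symm (u n, v n)) atTop (𝓝 x) := by
    have := ((continuous_chart_symm c).tendsto (chart c x)).comp (hu.prodMk_nhds hv)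
    rwa [hx] at this
  refine mem_closure_of_tendsto hlim (Eventually.of_forall fun n => ?_)
  -- In either chart `z₀ w₁` is, up to sign, a monomial in `u` and `v`; its nonvanishing also puts
  -- the point in the chart `z₀ ≠ 0`.
  have hne : invariant 0 1 ((chart c).symm (u n, v n)) ≠ 0 := by
    rw [invariant_chart_symm]
    have h1 := hu0 n
    have h2 := hv0 n
    split_ifs <;> simp [h1, h2]
  refine ⟨?_, hne⟩
  obtain ⟨q, hq⟩ := proj_surjective ((chart c).symm (u n, v n))
  rw [← hq] at hne ⊢
  exact proj_mem_chartSource.2 (left_ne_zero_of_mul hne)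

/-- The base point of the zero section. -/
def basePt : Space := (chart 0).symm 0

lemma basePt_mem : basePt ∈ chartSource 0 := chart_symm_mem 0 0

/-- The expression of a map in the chart `z₀ ≠ 0`. -/
def chartMap (φ : Space → Space) : ℂ × ℂ → ℂ × ℂ := chart 0 ∘ φ ∘ (chart 0).symm

lemma chartExpr_eq_chartMap {φ : Space → Space} {x : Space} (hx : x ∈ chartSource 0)
    (hφx : φ x ∈ chartSource 0) : chartExpr φ x = chartMap φ := by
  rw [chartExpr, chartIndex_eq_zero hx, chartIndex_eq_zero hφx]
  rfl

lemma chartMap_properties {φ : Space → Space} (hφ : ContMDiff 𝓘(ℝ, ℂ × ℂ) 𝓘(ℝ, ℂ × ℂ) ∞ φ)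
    (hg : PreservesMetric φ) (hI : IsHolomorphic φ) {y : ℂ × ℂ}
    (hy : φ ((chart 0).symm y) ∈ chartSource 0) :
    ContDiffAt ℝ ∞ (chartMap φ) y ∧ DifferentiableAt ℂ (chartMap φ) y ∧
      ∀ v w, chartMetric (chartMap φ y) (fderiv ℂ (chartMap φ) y v) (fderiv ℂ (chartMap φ) y w)
        = chartMetric y v w := by
  have hx := chart_symm_mem 0 y
  have h1 := contDiffAt_chartExpr hφ ((chart 0).symm y)
  have h2 := differentiableAt_chartExpr hφ hI ((chart 0).symm y)
  have h3 := mfderiv_eq_fderiv_chartExpr hφ ((chart 0).symm y)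
  rw [chartExpr_eq_chartMap hx hy, chartIndex_eq_zero hx, chart_chart_symm] at h1 h2 h3
  refine ⟨h1, h2, fun v w => ?_⟩
  have h4 := hg ((chart 0).symm y) v w
  rw [h3] at h4
  have e1 := metric_eq_chartMetric hy (fderiv ℝ (chartMap φ) y v) (fderiv ℝ (chartMap φ) y w)
  have e2 := metric_eq_chartMetric hx v w
  rw [chart_chart_symm] at e2
  rw [← fderiv_real_eq h2, ← fderiv_real_eq h2]
  exact e1.symm.trans (h4.trans e2)

/-- A holomorphic isometry that fixes the base point to first order is the identity. -/
theorem eq_self_of_fderiv_eq {φ : Space → Space}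
    (hφ : ContMDiff 𝓘(ℝ, ℂ × ℂ) 𝓘(ℝ, ℂ × ℂ) ∞ φ) (hg : PreservesMetric φ)
    (hI : IsHolomorphic φ) (h0 : φ basePt = basePt)
    (h1 : ∀ v, fderiv ℂ (chartMap φ) 0 v = v) (x : Space) : φ x = x := by
  have hev : ∀ᶠ y in 𝓝 (0 : ℂ × ℂ), φ ((chart 0).symm y) ∈ chartSource 0 := by
    refine (hφ.continuous.comp (continuous_chart_symm 0)).continuousAt.eventually
      ((isOpen_chartSource 0).mem_nhds ?_)
    change φ basePt ∈ _
    rw [h0]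
    exact basePt_mem
  have hf0 : chartMap φ 0 = 0 := by
    change chart 0 (φ basePt) = 0
    rw [h0, basePt, chart_chart_symm]
  have key := eventually_eq_self_of_preserves_metric chartMetric (chartMap φ)
    (contDiff_chartMetric.contDiffAt.of_le (by simp))
    (fun v w => by
      simp only [chartMetric_zero, Prod.smul_fst, Prod.smul_snd, smul_eq_mul, map_mul,
        Complex.conj_I]
      congr 1
      linear_combination (-(v.1 * conj w.1) - v.2 * conj w.2) * Complex.I_mul_I)
    (fun v hv => by
      have h := hv v
      rw [chartMetric_zero, Complex.mul_conj, Complex.mul_conj, Complex.add_re,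
        Complex.ofReal_re, Complex.ofReal_re] at h
      have p1 := Complex.normSq_nonneg v.1
      have p2 := Complex.normSq_nonneg v.2
      exact Prod.ext (Complex.normSq_eq_zero.1 (by linarith))
        (Complex.normSq_eq_zero.1 (by linarith)))
    (hev.mono fun y hy => by
      obtain ⟨k1, k2, k3⟩ := chartMap_properties hφ hg hI hy
      exact ⟨k1.of_le (WithTop.coe_le_coe.2 le_top), k2, k3⟩) hf0 h1
  -- `φ` may leave the chart `z₀ ≠ 0`, so the identity theorem is applied not to `chartMap φ` but to
  -- the invariants, which are entire on the line `ℂ y`. The neighbourhood given by `key` may depend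
  -- on `y`, which does no harm on a single line.
  have hinv : ∀ a b y, invariant a b (φ ((chart 0).symm y)) = invariant a b ((chart 0).symm y) := by
    intro a b y
    have hl : Differentiable ℂ fun ζ : ℂ => ζ • y := by fun_prop
    have hl0 : Tendsto (fun ζ : ℂ => ζ • y) (𝓝 0) (𝓝 0) := by
      simpa using hl.continuous.tendsto 0
    have d1 : Differentiable ℂ fun ζ : ℂ => invariant a b (φ ((chart 0).symm (ζ • y))) :=
      (differentiable_invariant_comp hφ hI a b).comp hl
    have d2 : Differentiable ℂ fun ζ : ℂ => invariant a b ((chart 0).symm (ζ • y)) := by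
      simp only [invariant_chart_symm]
      exact (differentiable_invariant_chart a b 0).comp hl
    have e : (fun ζ : ℂ => invariant a b (φ ((chart 0).symm (ζ • y)))) =ᶠ[𝓝 0]
        fun ζ : ℂ => invariant a b ((chart 0).symm (ζ • y)) := by
      filter_upwards [key y, hl0.eventually hev] with ζ hζ hm
      exact congrArg (invariant a b)
        (((chart 0).left_inv hm).symm.trans (congrArg (chart 0).symm hζ))
    have := (Complex.analyticOnNhd_univ_iff_differentiable.2 d1).eq_of_eventuallyEq
      (Complex.analyticOnNhd_univ_iff_differentiable.2 d2) e
    simpa using congrFun this 1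
  have hid : φ = id := by
    refine Continuous.ext_on dense_chart hφ.continuous continuous_id ?_
    rintro x ⟨hx, hne⟩
    have hs : (chart 0).symm (chart 0 x) = x := (chart 0).left_inv hx
    have h := fun a b => hinv a b (chart 0 x)
    rw [hs] at h
    refine (eq_of_invariant_eq (fun a b => (h a b).symm) ⟨0, hne⟩).symm
  exact congrFun hid x

/-! ### Every holomorphic isometry comes from `U(1) × SU(2)` -/

lemma mem_specialUnitaryGroup_of_normSq {z w : ℂ} (h : z * conj z + w * conj w = 1) :
    !![z, w; -conj w, conj z] ∈ Matrix.specialUnitaryGroup (Fin 2) ℂ := by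
  rw [Matrix.mem_specialUnitaryGroup_iff, Matrix.mem_unitaryGroup_iff]
  constructor
  · ext i j
    fin_cases i <;> fin_cases j <;> simp [Matrix.mul_apply, Fin.sum_univ_two] <;>
      first | ring1 | linear_combination h
  · rw [Matrix.det_fin_two_of]
    linear_combination h

/-- `SU(2)` acts transitively on the zero section. -/
lemma exists_spaceAction_basePt {x : Space} (hx : ∀ a, invariant a (1 - a) x = 0) :
    ∃ A, spaceAction 1 A basePt = x := by
  obtain ⟨q, rfl⟩ := proj_surjective x
  have hw := wc_eq_zero_of_invariant hx
  obtain ⟨h1, -⟩ := (momentMap_eq_iff q.1).1 q.2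
  rw [hw 0, hw 1, zero_mul, sub_zero, sub_zero] at h1
  -- The base point has `z = (1, 0)` and `w = 0`, so it is sent to the first row of the matrix, here
  -- `(z₀, z₁)`.
  refine ⟨⟨_, mem_specialUnitaryGroup_of_normSq h1⟩, ?_⟩
  change proj (levelAction 1 _ (sectionMap 0 0)) = proj q
  congr 1
  apply Subtype.ext
  rw [coe_levelAction]
  change linearAction 1 _ (sectionFlat 0 0) = q.1
  refine flat_ext (Fin.forall_fin_two.2 ?_) fun b => ?_
  · simp [zc_linearAction, zc_sectionFlat_zero]
  · simp [wc_linearAction, wc_sectionFlat_zero, hw]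

lemma chart_snd (x : Space) : (chart 0 x).2 = invariant 0 1 x := by
  obtain ⟨q, rfl⟩ := proj_surjective x
  rfl

/-- The diagonal element of `SU(2)` with first entry `d`. -/
def diagonalElement (d : Circle) : Matrix.specialUnitaryGroup (Fin 2) ℂ :=
  ⟨!![(d : ℂ), 0; -conj 0, conj (d : ℂ)],
    mem_specialUnitaryGroup_of_normSq (by simpa using circle_mul_conj d)⟩

/-- The maximal torus acts on the chart `z₀ ≠ 0` by diagonal matrices. -/
lemma chart_spaceAction_diagonal (t d : Circle) (x : Space) :
    chart 0 (spaceAction t (diagonalElement d) x)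
      = (conj ((d : ℂ) * d) * (chart 0 x).1, (t : ℂ) * t * (d * d) * (chart 0 x).2) := by
  obtain ⟨q, rfl⟩ := proj_surjective x
  change coord 0 (linearAction t (diagonalElement d) q.1) = (_ * (coord 0 q.1).1, _ * (coord 0 q.1).2)
  have hd := circle_mul_conj d
  have hd0 : (d : ℂ) ≠ 0 := d.coe_ne_zero
  have ht0 : (t : ℂ) ≠ 0 := t.coe_ne_zero
  have hinv : conj (d : ℂ) = (d : ℂ)⁻¹ := eq_inv_of_mul_eq_one_right hd
  simp only [coord, zc_linearAction, wc_linearAction, diagonalElement, sub_zero]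
  refine Prod.ext ?_ ?_
  -- No assumption `z₀ ≠ 0` is needed: division by zero makes both first components vanish. This
  -- lets `hchart` in `isometryAction_surjective` hold on all of `ℂ²`.
  · simp [hinv]
    rw [mul_div_mul_left _ _ ht0]
    field_simp
  · simp
    ring

/-- A complex linear isometry of `ℂ²` that preserves the first coordinate axis is diagonal. -/
lemma diagonal_of_isometry (D : ℂ × ℂ →L[ℂ] ℂ × ℂ) (h2 : (D (1, 0)).2 = 0)
    (hD : ∀ v w, chartMetric 0 (D v) (D w) = chartMetric 0 v w) :
    ∃ α β : ℂ, ‖α‖ = 1 ∧ ‖β‖ = 1 ∧ ∀ v, D v = (α * v.1, β * v.2) := by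
  have hsplit : ∀ v, D v = v.1 • D (1, 0) + v.2 • D (0, 1) := fun v => by
    rw [← map_smul, ← map_smul, ← map_add]
    simp
  have h11 := hD (1, 0) (1, 0)
  have h12 := hD (1, 0) (0, 1)
  -- The metric is only the real part of the Hermitian form; the factor `i` gives access to the
  -- imaginary part.
  have h12' := hD (Complex.I • (1, 0)) (0, 1)
  have h22 := hD (0, 1) (0, 1)
  rw [map_smul] at h12'
  simp only [chartMetric_zero, h2, Prod.smul_fst, Prod.smul_snd, smul_eq_mul] at h11 h12 h12' h22
  generalize hα : (D (1, 0)).1 = α at *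
  generalize hγ : (D (0, 1)).1 = γ at *
  generalize hβ : (D (0, 1)).2 = β at *
  have hn : ∀ z : ℂ, (z * conj z).re = 1 → ‖z‖ = 1 := fun z hz => by
    rw [Complex.mul_conj, Complex.ofReal_re, Complex.normSq_eq_norm_sq] at hz
    exact (pow_eq_one_iff_of_nonneg (norm_nonneg _) (by norm_num)).1 hz
  have hα1 : ‖α‖ = 1 := hn α (by simpa using h11)
  have hγ0 : γ = 0 := by
    have h : α * conj γ = 0 := by
      apply Complex.ext
      · simpa using h12
      · simp at h12' ⊢
        linarith
    have hα0 : α ≠ 0 := by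
      rintro rfl
      simp at hα1
    simpa [hα0] using h
  have hβ1 : ‖β‖ = 1 := hn β (by simpa [hγ0] using h22)
  refine ⟨α, β, hα1, hβ1, fun v => ?_⟩
  rw [hsplit v]
  refine Prod.ext ?_ ?_
  · simp [hα, hγ, hγ0, mul_comm]
  · simp [h2, hβ, mul_comm]

/-- An element of `SU(2)` corrects the image of the base point, a torus element corrects the
derivative there, and rigidity does the rest. -/
theorem isometryAction_surjective : Function.Surjective isometryAction := by
  intro φ
  have hzero : ∀ (ψ : holomorphicIsometryGroup) (u : ℂ) (a : Fin 2),
      invariant a (1 - a) (ψ.1 ((chart 0).symm (u, 0))) = 0 := fun ψ u a =>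
    invariant_eq_zero ψ.2.1 ψ.2.2.2.2 ψ.1.injective u a
  obtain ⟨A, hA⟩ := exists_spaceAction_basePt (x := φ.1 basePt) (hzero φ 0)
  set g := isometryAction (1, MulOpposite.op A) with hg
  obtain ⟨ψ, hψ⟩ : ∃ ψ, ψ = g⁻¹ * φ := ⟨_, rfl⟩
  have hφ : φ = g * ψ := by rw [hψ, mul_inv_cancel_left]
  have hψ0 : ψ.1 basePt = basePt := by
    have h1 : g.1 (ψ.1 basePt) = g.1 basePt := by
      change (g * ψ).1 basePt = _
      rw [← hφ, ← hA]
      rfl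
    exact g.1.injective h1
  obtain ⟨hs, -, hm, hI⟩ := ψ.2
  have hmem : ψ.1 ((chart 0).symm 0) ∈ chartSource 0 := by
    change ψ.1 basePt ∈ _
    rw [hψ0]
    exact basePt_mem
  obtain ⟨-, hd, hiso⟩ := chartMap_properties hs hm hI hmem
  have hF0 : chartMap ψ.1 0 = 0 := by
    change chart 0 (ψ.1 basePt) = 0
    rw [hψ0, basePt, chart_chart_symm]
  rw [hF0] at hiso
  -- The second coordinate is the invariant `z₀ w₁`, which vanishes along the image of the zero
  -- section `v = 0`.
  have h2 : (fderiv ℂ (chartMap ψ.1) 0 (1, 0)).2 = 0 := by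
    have hl : HasDerivAt (fun u : ℂ => ((u, 0) : ℂ × ℂ)) (1, 0) 0 :=
      (hasDerivAt_id (0 : ℂ)).prodMk (hasDerivAt_const (0 : ℂ) (0 : ℂ))
    have h := hd.hasFDerivAt.comp_hasDerivAt (f := fun u : ℂ => ((u, 0) : ℂ × ℂ)) (0 : ℂ) hl
    have h' : HasDerivAt (fun u : ℂ => (chartMap ψ.1 (u, 0)).2)
        (fderiv ℂ (chartMap ψ.1) 0 (1, 0)).2 0 :=
      (ContinuousLinearMap.snd ℂ ℂ ℂ).hasFDerivAt.comp_hasDerivAt (0 : ℂ) h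
    refine h'.unique ((hasDerivAt_const (0 : ℂ) (0 : ℂ)).congr_of_eventuallyEq
      (Eventually.of_forall fun u => ?_))
    exact (chart_snd _).trans (hzero ψ u 0)
  obtain ⟨α, β, hα, hβ, hD⟩ := diagonal_of_isometry _ h2 hiso
  -- The torus acts by `diag(d̄², s² d²)`, which has to be `diag(ᾱ, β̄)`. So `d² = α` and `s²` is
  -- the conjugate of `α β`.
  obtain ⟨d, hd2⟩ := exists_circle_mul_self hα
  obtain ⟨s, hs2⟩ := exists_circle_mul_self (z := conj (α * β)) (by simp [hα, hβ])
  have hα' : α * conj α = 1 := by rw [Complex.mul_conj, Complex.normSq_eq_norm_sq, hα]; simp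
  have hβ' : β * conj β = 1 := by rw [Complex.mul_conj, Complex.normSq_eq_norm_sq, hβ]; simp
  set k := isometryAction (s, MulOpposite.op (diagonalElement d)) with hk
  have hkψ : k * ψ = 1 := by
    obtain ⟨hs', -, hm', hI'⟩ := (k * ψ).2
    let T : ℂ × ℂ →L[ℂ] ℂ × ℂ :=
      (conj α • ContinuousLinearMap.fst ℂ ℂ ℂ).prod
        ((conj (α * β) * α) • ContinuousLinearMap.snd ℂ ℂ ℂ)
    have hT : ∀ v, T v = (conj α * v.1, conj (α * β) * α * v.2) := fun v => rfl
    have hchart : chartMap (k * ψ).1 = T ∘ chartMap ψ.1 := by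
      funext y
      refine (chart_spaceAction_diagonal s d (ψ.1 ((chart 0).symm y))).trans ?_
      rw [hd2, hs2]
      rfl
    refine Subtype.ext (Homeomorph.ext fun x => eq_self_of_fderiv_eq hs' hm' hI' ?_ ?_ x)
    · have h1 : spaceAction s (diagonalElement d) basePt ∈ chartSource 0 := by
        have e : basePt = proj (sectionMap 0 0) := rfl
        rw [e, spaceAction_proj, proj_mem_chartSource, coe_levelAction]
        change zc 0 (linearAction s _ (sectionFlat 0 0)) ≠ 0
        simp [zc_linearAction, zc_sectionFlat_zero, diagonalElement]
      change spaceAction s (diagonalElement d) (ψ.1 basePt) = basePt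
      rw [hψ0]
      refine (chart 0).injOn h1 basePt_mem ?_
      rw [chart_spaceAction_diagonal, basePt, chart_chart_symm]
      simp
    · intro v
      have h := (T.hasFDerivAt (x := chartMap ψ.1 0)).comp 0 hd.hasFDerivAt
      rw [hchart, h.fderiv, ContinuousLinearMap.comp_apply, hD, hT]
      refine Prod.ext ?_ ?_
      · dsimp only
        linear_combination v.1 * hα'
      · simp only [map_mul]
        linear_combination v.2 * β * conj β * hα' + v.2 * hβ'
  have hψk : ψ = k⁻¹ := eq_inv_of_mul_eq_one_right hkψ
  rw [hφ, hψk]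
  exact ⟨(1, MulOpposite.op A) * (s, MulOpposite.op (diagonalElement d))⁻¹, by
    rw [map_mul, map_inv]⟩

end EguchiHanson

end

/-! ### Assembly of the theorem -/

open EguchiHanson

theorem mainTheorem9 :
    ∃ (L : Circle →* EguchiHanson.holomorphicIsometryGroup)
      (R : (Matrix.specialUnitaryGroup (Fin 2) ℂ)ᵐᵒᵖ →* EguchiHanson.holomorphicIsometryGroup)
      (Φ : (Matrix.unitaryGroup (Fin 2) ℂ ⧸ EguchiHanson.pmOne) ≃* EguchiHanson.holomorphicIsometryGroup),
      (∀ (t : Circle) (q : EguchiHanson.LevelSet), (L t).1 (EguchiHanson.proj q) = EguchiHanson.proj (EguchiHanson.leftMul t q)) ∧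
      (∀ (A : Matrix.specialUnitaryGroup (Fin 2) ℂ) (q : EguchiHanson.LevelSet),
        (R (MulOpposite.op A)).1 (EguchiHanson.proj q) = EguchiHanson.proj (EguchiHanson.rightMul q A)) ∧
      (∀ (t : Circle) (A : (Matrix.specialUnitaryGroup (Fin 2) ℂ)ᵐᵒᵖ), Commute (L t) (R A)) ∧
      (∀ t : Circle, L t = 1 ↔ (t : ℂ) = 1 ∨ (t : ℂ) = -1) ∧
      (∀ A : Matrix.specialUnitaryGroup (Fin 2) ℂ, R (MulOpposite.op A) = 1 ↔
        (A : Matrix (Fin 2) (Fin 2) ℂ) = 1 ∨ (A : Matrix (Fin 2) (Fin 2) ℂ) = -1) ∧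
      ∀ (t : Circle) (A : Matrix.specialUnitaryGroup (Fin 2) ℂ),
        Φ (QuotientGroup.mk (EguchiHanson.scale t A)) = L t * R (MulOpposite.op A⁻¹) := by
  -- Inversion on `SU(2)` turns the right action into the left action `q ↦ λ q A⁻¹` and does not
  -- change the image.
  have h' : Function.Surjective leftIsometryAction := by
    intro φ
    obtain ⟨⟨t, A⟩, rfl⟩ := isometryAction_surjective φ
    refine ⟨(t, A.unop⁻¹), ?_⟩
    rw [leftIsometryAction_apply, inv_inv, MulOpposite.op_unop]
  refine ⟨isometryAction.comp (MonoidHom.inl _ _), isometryAction.comp (MonoidHom.inr _ _),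
    unitaryQuotientEquiv h', fun t q => ?_, fun A q => ?_, fun t A => ?_, fun t => ?_, fun A => ?_,
    fun t A => ?_⟩
  · change proj (leftMul t (rightMul q 1)) = _
    congr 2
    apply Subtype.ext
    exact flat_ext (Fin.forall_fin_two.2 (by simp [rightMul, zc_vecMul]))
      (Fin.forall_fin_two.2 (by simp [rightMul, wc_vecMul]))
  · change proj (leftMul 1 (rightMul q A)) = _
    congr 1
    apply Subtype.ext
    simp [leftMul]
  · exact (MonoidHom.commute_inl_inr t A).map isometryAction
  · change isometryAction (t, MulOpposite.op 1) = 1 ↔ _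
    rw [isometryAction_eq_one_iff]
    simp
  · change isometryAction (1, MulOpposite.op A) = 1 ↔ _
    rw [isometryAction_eq_one_iff]
    simp
  · rw [unitaryQuotientEquiv_mk, leftIsometryAction_apply, MonoidHom.comp_apply,
      MonoidHom.comp_apply, ← map_mul]
    simp
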